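/- Let $V$ be a finite-dimensional Hermitian vector space of complex dimension $n$, with volume form $\omega_V=\left(\frac{i}{2\pi}\partial\bar\partial\|z\|^2\right)^n$, let $\Omega\subset V$ be a domain, and let $p:\Omega\to(0,\infty)$ be continuous. For $k\ge 0$ let $K_{\Omega,p^k}(z,w)$ be the weighted Bergman kernel of $(\Omega,p^k)$, that is, the reproducing kernel of the space of holomorphic functions $f$ on $\Omega$ with $\int_\Omega|f|^2p^k\,\omega_V<\infty$. The virtual Bergman kernel of $(\Omega,p)$ is $$L_0(z,w;r)=\sum_{k=0}^\infty K_{\Omega,p^k}(z,w)\,r^k ,\qquad \mathcal L_0(z,r)=L_0(z,z;r).$$ For $m\ge 1$ let $$\widehat\Omega_m=\{(z,Z)\in\Omega\times\mathbb C^m:\ \|Z\|^2<p(z)\},$$ where $\|\cdot\|$ is the norm of the standard Hermitian product $\langle Z,W\rangle=\sum_j Z_j\overline{W_j}$, and let $\widehat K_m$ be its Bergman kernel, that is, the reproducing kernel of the space of holomorphic functions on $\widehat\Omega_m$ that are square-integrable with respect to $\omega_V(z)\wedge\omega_m(Z)$, $\omega_m(Z)=\left(\frac{i}{2\pi}\partial\bar\partial\|Z\|^2\right)^m$.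 Put $$L_m(z,w;r)=\frac1{m!}\frac{\partial^m}{\partial r^m}L_0(z,w;r),\qquad \mathcal L_m(z,r)=\frac1{m!}\frac{\partial^m}{\partial r^m}\mathcal L_0(z,r).$$ Then all these Bergman kernels exist, and for all $(z,Z),(w,W)\in\widehat\Omega_m$ the series $L_0(z,w;r)$ converges for all complex $r$ in a neighbourhood of $\langle Z,W\rangle$, its sum is analytic at $r=\langle Z,W\rangle$, and $$\widehat K_m\big((z,Z),(w,W)\big)=L_m\big(z,w;\langle Z,W\rangle\big)=\sum_{k=0}^\infty\binom{k+m}{m}K_{\Omega,p^{k+m}}(z,w)\,\langle Z,W\rangle^k ,$$ the last series being convergent. In particular, on the diagonal, $\widehat K_m\big((z,Z),(z,Z)\big)=\mathcal L_m\big(z,\|Z\|^2\big)$, with $r$ a real variable in the definition of $\mathcal L_m$. -/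

import Mathlib

open MeasureTheory Topology
open scoped ComplexConjugate

noncomputable section

/-- The volume form `ω_V = ((i / 2π) ∂∂̄ ‖z‖²) ^ n` of a Hermitian vector space `V` of complex
dimension `n`, as a measure. In orthonormal coordinates `z_j = x_j + i y_j` one has
`(i / 2π) ∂∂̄ ‖z‖² = ∑ j, (1 / π) dx_j ∧ dy_j`, so its `n`-th exterior power is `n! / π ^ n` times
the Euclidean (Lebesgue) volume of the real inner product space underlying `V`. -/
def hermitianVolume (V : Type*) [NormedAddCommGroup V] [InnerProductSpace ℂ V]
    [FiniteDimensional ℂ V] [MeasurableSpace V] [BorelSpace V] : Measure V :=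
  letI : InnerProductSpace ℝ V := InnerProductSpace.rclikeToReal ℂ V
  haveI : FiniteDimensional ℝ V := FiniteDimensional.complexToReal V
  ENNReal.ofReal ((Module.finrank ℂ V).factorial / Real.pi ^ Module.finrank ℂ V) •
    (volume : Measure V)

/-- Membership in the weighted Bergman space `H(D, q)` with respect to the measure `μ`:
`f` is holomorphic on the open set `D` and `∫_D |f|² q dμ < ∞`. Only the values of `f` and `q`
on `D` matter. -/
def MemBergman {E : Type*} [NormedAddCommGroup E] [NormedSpace ℂ E] [MeasurableSpace E]
    (μ : Measure E) (D : Set E) (q : E → ℝ) (f : E → ℂ) : Prop :=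
  DifferentiableOn ℂ f D ∧ IntegrableOn (fun x => ‖f x‖ ^ 2 * q x) D μ

/-- `K` is a reproducing kernel of the weighted Bergman space `H(D, q)`: for every `y ∈ D` the
function `K(·, y)` belongs to `H(D, q)`, and `f(y) = (f | K(·, y))` for all `f ∈ H(D, q)`.
These properties determine `K` on `D × D`. -/
def IsBergmanKernel {E : Type*} [NormedAddCommGroup E] [NormedSpace ℂ E] [MeasurableSpace E]
    (μ : Measure E) (D : Set E) (q : E → ℝ) (K : E → E → ℂ) : Prop :=
  ∀ y ∈ D, MemBergman μ D q (fun x => K x y) ∧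
    ∀ f : E → ℂ, MemBergman μ D q f → f y = ∫ x in D, f x * conj (K x y) * (q x : ℂ) ∂μ

open Classical in
/-- The (weighted) Bergman kernel of `D` with weight `q`: the reproducing kernel of `H(D, q)`
(zero should there be none). Its values off `D × D` are irrelevant. -/
def bergmanKernel {E : Type*} [NormedAddCommGroup E] [NormedSpace ℂ E] [MeasurableSpace E]
    (μ : Measure E) (D : Set E) (q : E → ℝ) : E → E → ℂ :=
  if h : ∃ K : E → E → ℂ, IsBergmanKernel μ D q K then h.choose else 0

section Hermitian

variable {V : Type*} [NormedAddCommGroup V] [InnerProductSpace ℂ V]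
  [FiniteDimensional ℂ V] [MeasurableSpace V] [BorelSpace V]

/-- The kernel `K_{Ω, p ^ k}(z, w)`. -/
def powerKernel (Ω : Set V) (p : V → ℝ) (k : ℕ) : V → V → ℂ :=
  bergmanKernel (hermitianVolume V) Ω (fun z => p z ^ k)

/-- The virtual Bergman kernel `L₀(z, w; r) = ∑ k, K_{Ω, p ^ k}(z, w) r ^ k` of `(Ω, p)`. -/
def virtualBergmanKernel (Ω : Set V) (p : V → ℝ) (z w : V) (r : ℂ) : ℂ :=
  ∑' k : ℕ, powerKernel Ω p k z w * r ^ k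

/-- `L_m(z, w; r) = (1 / m!) ∂^m/∂r^m L₀(z, w; r)`, with `r` a complex variable. -/
def virtualBergmanDeriv (Ω : Set V) (p : V → ℝ) (m : ℕ) (z w : V) (r : ℂ) : ℂ :=
  (1 / (m.factorial : ℂ)) * iteratedDeriv m (fun s : ℂ => virtualBergmanKernel Ω p z w s) r

/-- The virtual Bergman kernel on the diagonal, `𝓛₀(z, r) = L₀(z, z; r)`, with `r` real. -/
def diagVirtualBergmanKernel (Ω : Set V) (p : V → ℝ) (z : V) (r : ℝ) : ℂ :=
  virtualBergmanKernel Ω p z z (r : ℂ)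

/-- `𝓛_m(z, r) = (1 / m!) ∂^m/∂r^m 𝓛₀(z, r)`, with `r` a real variable. -/
def diagVirtualBergmanDeriv (Ω : Set V) (p : V → ℝ) (m : ℕ) (z : V) (r : ℝ) : ℂ :=
  (1 / (m.factorial : ℂ)) * iteratedDeriv m (fun s : ℝ => diagVirtualBergmanKernel Ω p z s) r

/-- The inflated domain `{(z, Z) ∈ Ω × ℂ^m | ‖Z‖² < p(z)}`. -/
def inflatedDomain (Ω : Set V) (p : V → ℝ) (m : ℕ) : Set (V × EuclideanSpace ℂ (Fin m)) :=
  {x | x.1 ∈ Ω ∧ ‖x.2‖ ^ 2 < p x.1}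

/-- The volume form `ω_V(z) ∧ ω_m(Z)` on `V × ℂ^m`, as a measure. -/
def inflatedVolume (V : Type*) [NormedAddCommGroup V] [InnerProductSpace ℂ V]
    [FiniteDimensional ℂ V] [MeasurableSpace V] [BorelSpace V] (m : ℕ) :
    Measure (V × EuclideanSpace ℂ (Fin m)) :=
  (hermitianVolume V).prod (hermitianVolume (EuclideanSpace ℂ (Fin m)))

/-- The unweighted Bergman kernel of the inflated domain. -/
def inflatedBergmanKernel (Ω : Set V) (p : V → ℝ) (m : ℕ) :
    V × EuclideanSpace ℂ (Fin m) → V × EuclideanSpace ℂ (Fin m) → ℂ :=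
  bergmanKernel (inflatedVolume V m) (inflatedDomain Ω p m) (fun _ => 1)

end Hermitian

end

/-! ### Holomorphic functions: locally uniform limits, Taylor coefficients, parameter dependence -/

section ComplexAnalysis

open Metric Filter

variable {E : Type*} [NormedAddCommGroup E] [NormedSpace ℂ E]

/-! Expand a holomorphic function on the inflated domain into homogeneous parts in `Z`. On the fibre
`‖Z‖² < s` with `s = p(z)`, pairing `g` with `⟨Z, w⟩^k` selects the degree `k` part and yields
`s^(k+m) / C(k+m, m)` times its value at `w` (`setIntegral_mul_conj_inner_pow`). By Fubini, the
pairing of `f` with `C(k+m, m) K(z, w₀) ⟨Z, w⟩^k`, where `K` is the kernel for the weight `p^(k+m)`,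
is therefore the degree `k` part of `f` at `(w₀, w)` (`setIntegral_mul_conj_kernel_mul_inner_pow`).
For `f` the kernel of the inflated domain, the same pairing is also a conjugated point value of the
test function, so each homogeneous part of that kernel is known. Summation over `k` is just the
Taylor series along a complex line: neither completeness of an orthogonal system nor `L²`
convergence of the expansion is needed (`hasSum_kernel_hartogs`).

The constant comes from computing a Gaussian integral twice, once by the Bargmann–Fock reproducing
formula and once by slicing the Gaussian into balls.

Kernels exist because point evaluations are locally uniformly bounded, which makes the Bergman space
closed in `L²` and gives access to Riesz representation. The series for `L₀` is controlled by the
expansion at parallel fibre vectors slightly longer than `Z` and `W`; it may then be differentiated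
termwise. -/

theorem norm_fderiv_le_div_of_forall_norm_le {f : E → ℂ} {c : E} {r M : ℝ} (hr : 0 < r)
    (hf : DifferentiableOn ℂ f (ball c r)) (hM : ∀ x ∈ ball c r, ‖f x‖ ≤ M) :
    ‖fderiv ℂ f c‖ ≤ 2 * M / r := by
  refine Complex.norm_fderiv_le_div_of_mapsTo_ball hf (fun x hx => ?_) hr
  rw [mem_closedBall, dist_eq_norm]
  calc ‖f x - f c‖ ≤ ‖f x‖ + ‖f c‖ := norm_sub_le _ _
    _ ≤ M + M := add_le_add (hM x hx) (hM c (mem_ball_self hr))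
    _ = 2 * M := by ring

/-- A locally uniform limit of holomorphic functions on an open subset of a complex normed space
is holomorphic. -/
theorem differentiableOn_of_forall_exists_tendstoUniformlyOn {F : ℕ → E → ℂ} {f : E → ℂ} {U : Set E}
    (hU : IsOpen U) (hF : ∀ n, DifferentiableOn ℂ (F n) U)
    (h : ∀ x ∈ U, ∃ s ∈ 𝓝 x, TendstoUniformlyOn F f atTop s) : DifferentiableOn ℂ f U := by
  intro x hx
  obtain ⟨s, hs, hs'⟩ := h x hx
  obtain ⟨r, hr, hrs⟩ := Metric.mem_nhds_iff.1 (inter_mem hs (hU.mem_nhds hx))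
  have hr2 : 0 < r / 2 := half_pos hr
  have hsub : ∀ y ∈ ball x (r / 2), ball y (r / 2) ⊆ s ∩ U := fun y hy =>
    (ball_subset_ball' (by rw [mem_ball] at hy; linarith)).trans hrs
  have hd : ∀ n, ∀ y ∈ U, HasFDerivAt (F n) (fderiv ℂ (F n) y) y := fun n y hy =>
    ((hF n).differentiableAt (hU.mem_nhds hy)).hasFDerivAt
  -- Cauchy's estimate on balls of radius `r / 2` transfers the uniform Cauchy property to the
  -- derivatives: `2 (ε r / 8) / (r / 2) = ε / 2`.
  have hC : UniformCauchySeqOn (fun n => fderiv ℂ (F n)) atTop (ball x (r / 2)) := by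
    rw [Metric.uniformCauchySeqOn_iff]
    intro ε hε
    obtain ⟨N, hN⟩ := Metric.uniformCauchySeqOn_iff.1 hs'.uniformCauchySeqOn (ε * r / 8)
      (by positivity)
    refine ⟨N, fun i hi j hj y hy => ?_⟩
    have hyU : y ∈ U := (hsub y hy (mem_ball_self hr2)).2
    rw [dist_eq_norm, ← ((hd i y hyU).sub (hd j y hyU)).fderiv]
    refine (norm_fderiv_le_div_of_forall_norm_le (M := ε * r / 8) hr2
      (((hF i).sub (hF j)).mono fun z hz => (hsub y hy hz).2) fun z hz => ?_).trans_lt ?_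
    · have := hN i hi j hj z (hsub y hy hz).1
      rw [dist_eq_norm] at this
      exact this.le
    · field_simp
      linarith
  choose! g hg using fun y (hy : y ∈ ball x (r / 2)) =>
    cauchySeq_tendsto_of_complete (hC.cauchySeq hy)
  have := hasFDerivAt_of_tendstoUniformlyOn (g := f) isOpen_ball
    (hC.tendstoUniformlyOn_of_tendsto hg)
    (fun n y hy => hd n y (hsub y hy (mem_ball_self hr2)).2)
    (fun y hy => hs'.tendsto_at (hsub y hy (mem_ball_self hr2)).1) (mem_ball_self hr2)
  exact this.differentiableAt.differentiableWithinAt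

/-- The circle average picks out Taylor coefficients. -/
theorem circleAverage_conj_pow_mul {φ : ℂ → ℂ} (hφ : DiffContOnCl ℂ φ (ball 0 1)) (k : ℕ) :
    Real.circleAverage (fun t => conj t ^ k * φ t) 0 1 =
      (k.factorial : ℂ)⁻¹ * iteratedDeriv k φ 0 := by
  have h := hφ.circleIntegral_one_div_sub_center_pow_smul one_pos k
  rw [Real.circleAverage_eq_circleIntegral one_ne_zero]
  -- On the unit circle `conj z = z⁻¹`, so the integrand is the one in Cauchy's formula for the
  -- `k`-th derivative.
  have h2 : (∮ z in C(0, 1), (z - 0)⁻¹ • (conj z ^ k * φ z)) =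
      ∮ z in C(0, 1), (1 / (z - 0) ^ (k + 1)) • φ z := by
    refine circleIntegral.integral_congr zero_le_one fun z hz => ?_
    have hz1 : ‖z‖ = 1 := by simpa using hz
    have : conj z = z⁻¹ := by
      rw [Complex.inv_def, Complex.normSq_eq_norm_sq, hz1]; simp
    simp only [sub_zero, smul_eq_mul, this, pow_succ, one_div, inv_pow, mul_inv]
    ring
  rw [h2, h]
  have : (2 * (Real.pi : ℂ) * Complex.I) ≠ 0 := Complex.two_pi_I_ne_zero
  simp only [smul_eq_mul]
  field_simp

/-- Taylor coefficients in an additional complex variable of a holomorphic function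
are holomorphic in the parameters. -/
theorem differentiableOn_iteratedDeriv_snd [FiniteDimensional ℂ E] {U : Set (E × ℂ)}
    (hU : IsOpen U) {g : E × ℂ → ℂ} (hg : DifferentiableOn ℂ g U) (k : ℕ) :
    DifferentiableOn ℂ (fun x => iteratedDeriv k (fun t => g (x, t)) 0) {x | (x, (0 : ℂ)) ∈ U} := by
  intro x₀ hx₀
  have : ProperSpace E := FiniteDimensional.proper ℂ E
  borelize E
  obtain ⟨r, hr, hrU⟩ := Metric.isOpen_iff.1 hU _ hx₀
  have hsub : closedBall (x₀, (0 : ℂ)) (r / 2) ⊆ U :=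
    (closedBall_subset_ball (by linarith)).trans hrU
  obtain ⟨M, hM⟩ := (isCompact_closedBall (x₀, (0 : ℂ)) (r / 2)).exists_bound_of_continuousOn
    (hg.continuousOn.mono hsub)
  -- With this radius, balls of radius `ρ` about `(x, t)` stay where `‖g‖ ≤ M`, so Cauchy's estimate
  -- gives a bound on the derivative uniform in `x`. It dominates differentiation under the Cauchy
  -- integral over `‖t‖ = ρ`.
  set ρ := r / 4 with hρ
  have hρ0 : 0 < ρ := by positivity
  have hin : ∀ x ∈ ball x₀ ρ, ∀ t : ℂ, ‖t‖ ≤ ρ → ball (x, t) ρ ⊆ closedBall (x₀, (0 : ℂ)) (r / 2) := by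
    intro x hx t ht
    refine ball_subset_closedBall.trans (closedBall_subset_closedBall' ?_)
    rw [Prod.dist_eq]
    have : dist (x, t).1 (x₀, (0 : ℂ)).1 ≤ ρ := (mem_ball.1 hx).le
    have h2 : dist (x, t).2 (x₀, (0 : ℂ)).2 ≤ ρ := by simpa using ht
    have := max_le this h2
    linarith
  have hinU : ∀ x ∈ ball x₀ ρ, ∀ t : ℂ, ‖t‖ ≤ ρ → (x, t) ∈ U := fun x hx t ht =>
    hsub (hin x hx t ht (mem_ball_self hρ0))
  have hd : ∀ x ∈ ball x₀ ρ, ∀ t : ℂ, ‖t‖ ≤ ρ →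
      HasFDerivAt (fun y => g (y, t)) ((fderiv ℂ g (x, t)).comp (.inl ℂ E ℂ)) x := by
    intro x hx t ht
    exact (hg.differentiableAt (hU.mem_nhds (hinU x hx t ht))).hasFDerivAt.comp x
      (hasFDerivAt_prodMk_left x t)
  have hcont : ∀ x ∈ ball x₀ ρ, Continuous fun θ : ℝ => g (x, circleMap 0 ρ θ) := fun x hx =>
    hg.continuousOn.comp_continuous (by fun_prop) fun θ => hinU x hx _ (by simp [abs_of_pos hρ0])
  set w : ℝ → ℂ := fun θ => deriv (circleMap 0 ρ) θ * (1 / (circleMap 0 ρ θ - 0) ^ (k + 1)) with hw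
  have hwc : Continuous w := by
    simp only [hw, deriv_circleMap]
    refine Continuous.mul (by fun_prop) (continuous_const.div (by fun_prop) fun θ => ?_)
    simp [hρ0.ne']
  have hkey : HasFDerivAt (fun x => ∫ θ in Set.Ioc 0 (2 * Real.pi), w θ * g (x, circleMap 0 ρ θ))
      (∫ θ in Set.Ioc 0 (2 * Real.pi),
        w θ • (fderiv ℂ g (x₀, circleMap 0 ρ θ)).comp (.inl ℂ E ℂ)) x₀ := by
    refine hasFDerivAt_integral_of_dominated_of_fderiv_le
      (F := fun x θ => w θ * g (x, circleMap 0 ρ θ))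
      (F' := fun x θ => w θ • (fderiv ℂ g (x, circleMap 0 ρ θ)).comp (.inl ℂ E ℂ))
      (bound := fun θ => ‖w θ‖ * (2 * M / ρ))
      (ball_mem_nhds x₀ hρ0) ?_ ?_ ?_ ?_ ?_ ?_
    · filter_upwards [ball_mem_nhds x₀ hρ0] with x hx
      exact (hwc.mul (hcont x hx)).aestronglyMeasurable
    · exact ((hwc.mul (hcont x₀ (mem_ball_self hρ0))).integrableOn_Icc).mono_set
        Set.Ioc_subset_Icc_self
    · refine hwc.aestronglyMeasurable.smul ?_
      have h1 : Measurable fun θ : ℝ => fderiv ℂ g (x₀, circleMap 0 ρ θ) :=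
        (measurable_fderiv ℂ g).comp (by fun_prop)
      have h2 : Continuous fun L : (E × ℂ) →L[ℂ] ℂ => L.comp (.inl ℂ E ℂ) := by fun_prop
      exact h2.comp_aestronglyMeasurable h1.aestronglyMeasurable
    · refine Eventually.of_forall fun θ x hx => ?_
      have ht : ‖circleMap 0 ρ θ‖ ≤ ρ := by simp [abs_of_pos hρ0]
      rw [norm_smul]
      gcongr
      refine (ContinuousLinearMap.opNorm_comp_le _ _).trans ?_
      have h1 : ‖fderiv ℂ g (x, circleMap 0 ρ θ)‖ ≤ 2 * M / ρ :=
        norm_fderiv_le_div_of_forall_norm_le hρ0 (hg.mono ((hin x hx _ ht).trans hsub))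
          fun y hy => hM y (hin x hx _ ht hy)
      have h2 : ‖ContinuousLinearMap.inl ℂ E ℂ‖ ≤ 1 := ContinuousLinearMap.norm_inl_le_one ℂ E ℂ
      calc _ ≤ ‖fderiv ℂ g (x, circleMap 0 ρ θ)‖ * 1 := by gcongr
        _ ≤ _ := by simpa using h1
    · exact ((hwc.norm.mul continuous_const).integrableOn_Icc).mono_set Set.Ioc_subset_Icc_self
    · refine Eventually.of_forall fun θ x hx => ?_
      exact (hd x hx _ (by simp [abs_of_pos hρ0])).const_mul _
  have hev : (fun x => iteratedDeriv k (fun t => g (x, t)) 0) =ᶠ[𝓝 x₀] fun x =>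
      (2 * Real.pi * Complex.I / k.factorial)⁻¹ *
        ∫ θ in Set.Ioc 0 (2 * Real.pi), w θ * g (x, circleMap 0 ρ θ) := by
    filter_upwards [ball_mem_nhds x₀ hρ0] with x hx
    have h1 : DifferentiableOn ℂ (fun t => g (x, t)) (closedBall 0 ρ) := by
      refine hg.comp (by fun_prop) fun t ht => hinU x hx t (by simpa using ht)
    have h2 := h1.circleIntegral_one_div_sub_center_pow_smul hρ0 k
    have hne : (2 * Real.pi * Complex.I / k.factorial) ≠ 0 :=
      div_ne_zero Complex.two_pi_I_ne_zero (by exact_mod_cast k.factorial_ne_zero)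
    rw [eq_inv_mul_iff_mul_eq₀ hne, ← smul_eq_mul, ← h2, circleIntegral,
      intervalIntegral.integral_of_le Real.two_pi_pos.le]
    simp only [hw, smul_eq_mul, mul_assoc]
  exact ((hkey.differentiableAt.const_mul _).congr_of_eventuallyEq hev).differentiableWithinAt

end ComplexAnalysis

/-! ### Circle invariant measures and mean value properties -/

section Rotation

open Metric Filter

variable {E : Type*} [NormedAddCommGroup E] [NormedSpace ℂ E] [MeasurableSpace E]

/-- Measures on a complex vector space that are invariant under multiplication by unimodular
complex numbers. -/
def IsCircleInvariant (ρ : Measure E) : Prop :=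
  ∀ a : ℂ, ‖a‖ = 1 → MeasurePreserving (fun x : E => a • x) ρ ρ

theorem IsCircleInvariant.restrict {ρ : Measure E} (hρ : IsCircleInvariant ρ) {s : Set E}
    (hs : MeasurableSet s) (hinv : ∀ a : ℂ, ‖a‖ = 1 → ∀ x, a • x ∈ s ↔ x ∈ s) :
    IsCircleInvariant (ρ.restrict s) := by
  intro a ha
  have := (hρ a ha).restrict_preimage hs
  rwa [show (fun x : E => a • x) ⁻¹' s = s from Set.ext (hinv a ha)] at this

variable [BorelSpace E]

/-- The image of a Haar measure under a rotation is a Haar measure, hence a multiple of the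
original. The unit ball is preserved and has finite positive measure, so the factor is 1. -/
theorem isCircleInvariant_of_isAddHaarMeasure [FiniteDimensional ℂ E] (μ : Measure E)
    [μ.IsAddHaarMeasure] : IsCircleInvariant μ := by
  intro a ha
  have : ProperSpace E := FiniteDimensional.proper ℂ E
  have ha0 : a ≠ 0 := fun h => by simp [h] at ha
  refine ⟨(continuous_const_smul a).measurable, ?_⟩
  have hH : (μ.map (fun x : E => a • x)).IsAddHaarMeasure :=
    AddEquiv.isAddHaarMeasure_map μ (DistribMulAction.toAddEquiv₀ E a ha0)
      (continuous_const_smul a) (continuous_const_smul a⁻¹)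
  have h1 := Measure.isAddLeftInvariant_eq_smul (μ.map (fun x : E => a • x)) μ
  have hpre : (fun x : E => a • x) ⁻¹' ball 0 1 = ball 0 1 := by
    ext x; simp [norm_smul, ha]
  have h2 : μ (ball 0 1) = Measure.addHaarScalarFactor (μ.map (fun x : E => a • x)) μ •
      μ (ball 0 1) := by
    conv_lhs => rw [← hpre, ← Measure.map_apply (continuous_const_smul a).measurable
      measurableSet_ball, h1]
    rfl
  have h3 : Measure.addHaarScalarFactor (μ.map (fun x : E => a • x)) μ = 1 := by
    have hpos : μ (ball 0 1) ≠ 0 := (measure_ball_pos μ 0 one_pos).ne'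
    have hfin : μ (ball 0 1) ≠ ⊤ := measure_ball_lt_top.ne
    rw [ENNReal.smul_def, smul_eq_mul] at h2
    have := (ENNReal.mul_eq_right hpos hfin).1 h2.symm
    exact_mod_cast this
  rw [h1, h3, one_smul]

/-- Integration against a circle invariant measure may be preceded by averaging over circles. -/
theorem IsCircleInvariant.integral_circleAverage [SecondCountableTopology E] {ρ : Measure E}
    [SFinite ρ] (hρ : IsCircleInvariant ρ)
    {F : E → ℂ} (hF : Integrable F ρ) :
    ∫ x, Real.circleAverage (fun t => F (t • x)) 0 1 ∂ρ = ∫ x, F x ∂ρ := by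
  set τ : Measure ℝ := volume.restrict (Set.Ioc 0 (2 * Real.pi)) with hτ
  have hmeas : Measurable (Function.uncurry fun (θ : ℝ) (x : E) => circleMap 0 1 θ • x) := by
    refine Continuous.measurable ?_
    simp only [Function.uncurry_def]
    fun_prop
  -- The skew product `(θ, x) ↦ (θ, e^{iθ} x)` preserves the product measure, which supplies the
  -- joint integrability for Fubini.
  have hmp : MeasurePreserving (fun p : ℝ × E => (p.1, circleMap 0 1 p.1 • p.2))
      (τ.prod ρ) (τ.prod ρ) :=
    (MeasurePreserving.id τ).skew_product (g := fun (θ : ℝ) (x : E) => circleMap 0 1 θ • x)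
      hmeas (Eventually.of_forall fun θ => (hρ _ (by simp)).map_eq)
  have hint : Integrable (Function.uncurry fun (θ : ℝ) (x : E) => F (circleMap 0 1 θ • x))
      (τ.prod ρ) :=
    hmp.integrable_comp_of_integrable (hF.comp_snd τ)
  have hswap := integral_integral_swap hint
  have h1 : ∀ θ : ℝ, ∫ x, F (circleMap 0 1 θ • x) ∂ρ = ∫ x, F x ∂ρ := fun θ => by
    have h := hρ (circleMap 0 1 θ) (by simp)
    conv_rhs => rw [← h.map_eq]
    rw [integral_map h.measurable.aemeasurable]
    rw [h.map_eq]
    exact hF.aestronglyMeasurable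
  simp only [h1] at hswap
  simp only [Real.circleAverage_def, intervalIntegral.integral_of_le Real.two_pi_pos.le]
  rw [integral_smul, ← hτ, ← hswap, integral_const]
  simp only [hτ, measureReal_restrict_apply_univ, Real.volume_real_Ioc, sub_zero,
    max_eq_left Real.two_pi_pos.le, smul_smul]
  rw [inv_mul_cancel₀ Real.two_pi_pos.ne', one_smul]

/-- Mean value property with respect to a circle invariant measure. -/
theorem IsCircleInvariant.integral_eq_of_diffContOnCl [SecondCountableTopology E] {ρ : Measure E}
    [SFinite ρ] (hρ : IsCircleInvariant ρ) {F : E → ℂ} (hF : Integrable F ρ)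
    (hd : ∀ᵐ x ∂ρ, DiffContOnCl ℂ (fun t : ℂ => F (t • x)) (ball 0 1)) :
    ∫ x, F x ∂ρ = ρ.real Set.univ • F 0 := by
  rw [← hρ.integral_circleAverage hF, ← integral_const]
  refine integral_congr_ae ?_
  filter_upwards [hd] with x hx
  rw [DiffContOnCl.circleAverage (by simpa using hx), zero_smul]

/-- The sub-mean value inequality for the squared modulus of a holomorphic function. -/
theorem norm_sq_mul_measureReal_ball_le [FiniteDimensional ℂ E] (μ : Measure E)
    [μ.IsAddHaarMeasure] {f : E → ℂ} {U : Set E} (hf : DifferentiableOn ℂ f U) {y : E}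
    {r : ℝ} (hU : closedBall y r ⊆ U) :
    ‖f y‖ ^ 2 * μ.real (ball y r) ≤ ∫ x in ball y r, ‖f x‖ ^ 2 ∂μ := by
  have : ProperSpace E := FiniteDimensional.proper ℂ E
  have hmem : ∀ x ∈ closedBall (0 : E) r, y + x ∈ U := fun x hx => hU (by simpa using hx)
  have hcont : ContinuousOn (fun x => f (y + x) ^ 2) (closedBall 0 r) :=
    (hf.continuousOn.comp (by fun_prop) hmem).pow 2
  have hint : IntegrableOn (fun x => f (y + x) ^ 2) (ball 0 r) μ :=
    (hcont.integrableOn_compact (isCompact_closedBall 0 r)).mono_set ball_subset_closedBall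
  have hinv : IsCircleInvariant (μ.restrict (ball (0 : E) r)) :=
    (isCircleInvariant_of_isAddHaarMeasure μ).restrict measurableSet_ball
      fun a ha x => by simp [norm_smul, ha]
  -- The mean value property is applied to `f²`, which is holomorphic; absolute values are taken
  -- only afterwards.
  have hmv := hinv.integral_eq_of_diffContOnCl hint (by
    filter_upwards [ae_restrict_mem measurableSet_ball] with x hx
    refine DifferentiableOn.diffContOnCl ((hf.comp (s := closure (ball 0 1)) (by fun_prop)
      fun t ht => hmem _ ?_).pow 2)
    rw [closure_ball _ one_ne_zero] at ht
    simp only [mem_closedBall, dist_zero_right, norm_smul, mem_ball] at ht hx ⊢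
    nlinarith [norm_nonneg x, norm_nonneg t])
  have htrans : ∫ x in ball 0 r, ‖f (y + x) ^ 2‖ ∂μ = ∫ x in ball y r, ‖f x‖ ^ 2 ∂μ := by
    have h := (measurePreserving_add_left μ y).setIntegral_preimage_emb
      (measurableEmbedding_addLeft y) (fun x => ‖f x‖ ^ 2) (ball y r)
    simp only [norm_pow]
    rw [← h]
    congr 2
    ext x; simp
  have hball : μ.real (ball y r) = μ.real (ball 0 r) := by
    simp only [measureReal_def, Measure.addHaar_ball_center]
  simp only [add_zero, measureReal_restrict_apply_univ] at hmv
  calc ‖f y‖ ^ 2 * μ.real (ball y r) = ‖μ.real (ball (0 : E) r) • f y ^ 2‖ := by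
        rw [norm_smul, norm_pow, Real.norm_of_nonneg measureReal_nonneg, hball, mul_comm]
    _ = ‖∫ x in ball 0 r, f (y + x) ^ 2 ∂μ‖ := by rw [hmv]
    _ ≤ ∫ x in ball 0 r, ‖f (y + x) ^ 2‖ ∂μ := norm_integral_le_integral_norm _
    _ = _ := htrans

end Rotation

/-! ### Weighted Bergman spaces and existence of the reproducing kernel -/

section BergmanSpace

open Metric Filter

variable {E : Type*} [NormedAddCommGroup E] [NormedSpace ℂ E] [MeasurableSpace E]
  {μ : Measure E} {D : Set E} {q : E → ℝ}

theorem IsBergmanKernel.conj_symm {K : E → E → ℂ} (hK : IsBergmanKernel μ D q K) {x y : E}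
    (hx : x ∈ D) (hy : y ∈ D) : conj (K x y) = K y x := by
  rw [(hK y hy).2 _ (hK x hx).1, (hK x hx).2 _ (hK y hy).1, ← integral_conj]
  refine integral_congr_ae (Eventually.of_forall fun z => ?_)
  simp only [map_mul, Complex.conj_conj, Complex.conj_ofReal]
  ring

theorem norm_mul_sqrt_sq {X : Type*} {q : X → ℝ} {x : X} (hq : 0 ≤ q x) (f : X → ℂ) :
    ‖f x * (√(q x) : ℂ)‖ ^ 2 = ‖f x‖ ^ 2 * q x := by
  rw [norm_mul, mul_pow, Complex.norm_real, Real.norm_of_nonneg (Real.sqrt_nonneg _),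
    Real.sq_sqrt hq]

theorem norm_sq_eq_setIntegral {X : Type*} [MeasurableSpace X] {μ : Measure X} {D : Set X}
    {q : X → ℝ} (hD : MeasurableSet D) (hq0 : ∀ x ∈ D, 0 < q x)
    {F : Lp ℂ 2 (μ.restrict D)} {f : X → ℂ}
    (hF : F =ᵐ[μ.restrict D] fun x => f x * (√(q x) : ℂ)) :
    ∫ x in D, ‖f x‖ ^ 2 * q x ∂μ = ‖F‖ ^ 2 := by
  have h : inner ℂ F F = ((‖F‖ ^ 2 : ℝ) : ℂ) := by
    rw [inner_self_eq_norm_sq_to_K]; norm_cast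
  rw [L2.inner_def] at h
  have h2 : ∫ x in D, inner ℂ (F x) (F x) ∂μ = ∫ x in D, ((‖f x‖ ^ 2 * q x : ℝ) : ℂ) ∂μ := by
    refine integral_congr_ae ?_
    filter_upwards [hF, ae_restrict_mem hD] with x hx hxD
    rw [inner_self_eq_norm_sq_to_K, hx, ← norm_mul_sqrt_sq (hq0 x hxD).le f]
    norm_cast
  rw [h2, integral_complex_ofReal] at h
  exact_mod_cast h

variable [FiniteDimensional ℂ E] [BorelSpace E]

theorem aestronglyMeasurable_mul_sqrt (hD : IsOpen D) (hq : ContinuousOn q D) {f : E → ℂ}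
    (hf : DifferentiableOn ℂ f D) :
    AEStronglyMeasurable (fun x => f x * (√(q x) : ℂ)) (μ.restrict D) := by
  have : ProperSpace E := FiniteDimensional.proper ℂ E
  exact (hf.continuousOn.mul (Complex.continuous_ofReal.comp_continuousOn hq.sqrt)
    ).aestronglyMeasurable hD.measurableSet

theorem memBergman_iff_memLp (hD : IsOpen D) (hq : ContinuousOn q D) (hq0 : ∀ x ∈ D, 0 < q x)
    {f : E → ℂ} : MemBergman μ D q f ↔
      DifferentiableOn ℂ f D ∧ MemLp (fun x => f x * (√(q x) : ℂ)) 2 (μ.restrict D) := by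
  refine and_congr_right fun hf => ?_
  rw [memLp_two_iff_integrable_sq_norm (aestronglyMeasurable_mul_sqrt hD hq hf)]
  exact integrableOn_congr_fun (fun x hx => (norm_mul_sqrt_sq (hq0 x hx).le f).symm)
    hD.measurableSet

/-- Point evaluations are locally uniformly bounded on the weighted Bergman space. -/
theorem exists_norm_sq_le_setIntegral [μ.IsAddHaarMeasure] (hD : IsOpen D) (hq : ContinuousOn q D)
    (hq0 : ∀ x ∈ D, 0 < q x) {x : E} (hx : x ∈ D) :
    ∃ r > 0, ball x r ⊆ D ∧ ∃ C : ℝ, 0 < C ∧ ∀ f : E → ℂ, MemBergman μ D q f → ∀ y ∈ ball x r,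
      ‖f y‖ ^ 2 ≤ C * ∫ x in D, ‖f x‖ ^ 2 * q x ∂μ := by
  have : ProperSpace E := FiniteDimensional.proper ℂ E
  -- Near `x` the weight exceeds `q x / 2`, so there the weighted norm controls the unweighted one.
  have hev : ∀ᶠ y in 𝓝 x, q x / 2 < q y ∧ y ∈ D :=
    ((hq.continuousAt (hD.mem_nhds hx)).eventually (lt_mem_nhds (half_lt_self (hq0 x hx)))).and
      (hD.mem_nhds hx)
  obtain ⟨R, hR, hRq⟩ := Metric.eventually_nhds_iff_ball.1 hev
  set r := R / 4 with hr
  have hr0 : 0 < r := by positivity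
  have hm : 0 < μ.real (ball (0 : E) r) :=
    ENNReal.toReal_pos (measure_ball_pos μ 0 hr0).ne' measure_ball_lt_top.ne
  have hqx := hq0 x hx
  refine ⟨r, hr0, fun y hy => (hRq y (ball_subset_ball (by linarith) hy)).2,
    (q x / 2 * μ.real (ball (0 : E) r))⁻¹, by positivity, fun f hf y hy => ?_⟩
  have hsub : closedBall y r ⊆ ball x R := closedBall_subset_ball' (by
    rw [mem_ball] at hy; linarith)
  have hsubD : ball y r ⊆ D := fun z hz => (hRq z (hsub (ball_subset_closedBall hz))).2
  have h1 := norm_sq_mul_measureReal_ball_le μ hf.1 fun z hz => (hRq z (hsub hz)).2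
  have hball : μ.real (ball y r) = μ.real (ball 0 r) := by
    simp only [measureReal_def, Measure.addHaar_ball_center]
  rw [hball] at h1
  have hint : IntegrableOn (fun z => ‖f z‖ ^ 2) (ball y r) μ :=
    ((hf.1.continuousOn.mono fun z hz => (hRq z (hsub hz)).2).norm.pow 2).integrableOn_compact
      (isCompact_closedBall y r) |>.mono_set ball_subset_closedBall
  have h2 : q x / 2 * ∫ z in ball y r, ‖f z‖ ^ 2 ∂μ ≤ ∫ z in D, ‖f z‖ ^ 2 * q z ∂μ := by
    rw [← integral_const_mul]
    calc ∫ z in ball y r, q x / 2 * ‖f z‖ ^ 2 ∂μ ≤ ∫ z in ball y r, ‖f z‖ ^ 2 * q z ∂μ := by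
          refine setIntegral_mono_on (hint.const_mul _) (hf.2.mono_set hsubD) measurableSet_ball
            fun z hz => ?_
          rw [mul_comm]
          exact mul_le_mul_of_nonneg_left (hRq z (hsub (ball_subset_closedBall hz))).1.le
            (by positivity)
      _ ≤ _ := setIntegral_mono_set hf.2 (by
          filter_upwards [ae_restrict_mem hD.measurableSet] with z hz
          have := hq0 z hz
          simp only [Pi.zero_apply]
          positivity) hsubD.eventuallyLE
  rw [inv_mul_eq_div, le_div_iff₀ (by positivity)]
  calc ‖f y‖ ^ 2 * (q x / 2 * μ.real (ball 0 r)) = q x / 2 * (‖f y‖ ^ 2 * μ.real (ball 0 r)) := by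
        ring
    _ ≤ q x / 2 * ∫ z in ball y r, ‖f z‖ ^ 2 ∂μ := by gcongr
    _ ≤ _ := h2

/-- The weighted Bergman space, embedded in `L²(D)` by `f ↦ f √q`. -/
def bergmanSubmodule (μ : Measure E) (D : Set E) (q : E → ℝ) :
    Submodule ℂ (Lp ℂ 2 (μ.restrict D)) where
  carrier := {F | ∃ f : E → ℂ, DifferentiableOn ℂ f D ∧
    F =ᵐ[μ.restrict D] fun x => f x * (√(q x) : ℂ)}
  zero_mem' := ⟨0, differentiableOn_const 0, by
    filter_upwards [Lp.coeFn_zero ℂ 2 (μ.restrict D)] with x hx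
    simpa using hx⟩
  add_mem' := by
    rintro F G ⟨f, hf, hF⟩ ⟨g, hg, hG⟩
    refine ⟨f + g, hf.add hg, ?_⟩
    filter_upwards [Lp.coeFn_add F G, hF, hG] with x h1 h2 h3
    rw [h1, Pi.add_apply, h2, h3, Pi.add_apply, add_mul]
  smul_mem' := by
    rintro c F ⟨f, hf, hF⟩
    refine ⟨c • f, hf.const_smul c, ?_⟩
    filter_upwards [Lp.coeFn_smul c F, hF] with x h1 h2
    rw [h1, Pi.smul_apply, h2, Pi.smul_apply, smul_eq_mul, smul_eq_mul, mul_assoc]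

theorem memBergman_of_ae_eq (hD : IsOpen D) (hq : ContinuousOn q D) (hq0 : ∀ x ∈ D, 0 < q x)
    {F : Lp ℂ 2 (μ.restrict D)} {f : E → ℂ} (hf : DifferentiableOn ℂ f D)
    (hF : F =ᵐ[μ.restrict D] fun x => f x * (√(q x) : ℂ)) : MemBergman μ D q f :=
  (memBergman_iff_memLp hD hq hq0).2 ⟨hf, (Lp.memLp F).ae_eq hF⟩

/-- By the bound on point evaluations, `L²` convergence forces locally uniform convergence of the
holomorphic representatives, whose limit is holomorphic. An almost everywhere convergent subsequence
identifies it with the `L²` limit. -/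
theorem bergmanSubmodule_isClosed [μ.IsAddHaarMeasure] (hD : IsOpen D) (hq : ContinuousOn q D)
    (hq0 : ∀ x ∈ D, 0 < q x) : IsClosed (bergmanSubmodule μ D q : Set (Lp ℂ 2 (μ.restrict D))) := by
  refine IsSeqClosed.isClosed fun F G hF hG => ?_
  choose f hf hFf using hF
  have hloc : ∀ x ∈ D, ∃ s ∈ 𝓝 x, s ⊆ D ∧ UniformCauchySeqOn f atTop s := by
    intro x hx
    obtain ⟨r, hr, hrD, C, hC, hle⟩ := exists_norm_sq_le_setIntegral (μ := μ) hD hq hq0 hx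
    refine ⟨ball x r, ball_mem_nhds x hr, hrD, Metric.uniformCauchySeqOn_iff.2 fun ε hε => ?_⟩
    obtain ⟨N, hN⟩ := Metric.cauchySeq_iff.1 hG.cauchySeq (ε / √C) (by positivity)
    refine ⟨N, fun i hi j hj y hy => ?_⟩
    have hFij : (F i - F j : Lp ℂ 2 (μ.restrict D)) =ᵐ[μ.restrict D]
        fun x => (f i x - f j x) * (√(q x) : ℂ) := by
      filter_upwards [Lp.coeFn_sub (F i) (F j), hFf i, hFf j] with z h1 h2 h3
      rw [h1, Pi.sub_apply, h2, h3, sub_mul]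
    have h1 := hle (fun x => f i x - f j x)
      (memBergman_of_ae_eq hD hq hq0 ((hf i).sub (hf j)) hFij) y hy
    have h2 := hN i hi j hj
    rw [norm_sq_eq_setIntegral hD.measurableSet hq0 hFij] at h1
    rw [dist_eq_norm, lt_div_iff₀ (by positivity)] at h2
    rw [dist_eq_norm]
    refine lt_of_le_of_lt (Real.le_sqrt_of_sq_le h1 |>.trans_eq ?_) h2
    rw [Real.sqrt_mul hC.le, Real.sqrt_sq (norm_nonneg _), mul_comm]
  have hlim : ∀ x ∈ D, ∃ l, Tendsto (fun n => f n x) atTop (𝓝 l) := fun x hx => by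
    obtain ⟨s, hs, -, hC⟩ := hloc x hx
    exact cauchySeq_tendsto_of_complete (hC.cauchySeq (mem_of_mem_nhds hs))
  choose! g hg using hlim
  have hgd : DifferentiableOn ℂ g D :=
    differentiableOn_of_forall_exists_tendstoUniformlyOn hD hf fun x hx => by
      obtain ⟨s, hs, hsD, hC⟩ := hloc x hx
      exact ⟨s, hs, hC.tendstoUniformlyOn_of_tendsto fun y hy => hg y (hsD hy)⟩
  refine ⟨g, hgd, ?_⟩
  obtain ⟨ns, hns, hae⟩ := (tendstoInMeasure_of_tendsto_Lp hG).exists_seq_tendsto_ae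
  filter_upwards [hae, ae_all_iff.2 hFf, ae_restrict_mem hD.measurableSet] with x h1 h2 h3
  refine tendsto_nhds_unique h1 ?_
  simp only [h2]
  exact ((hg x h3).comp hns.tendsto_atTop).mul_const _

/-- The weighted Bergman space of an open set in a finite-dimensional complex vector space, with
a continuous positive weight, has a reproducing kernel. -/
theorem exists_isBergmanKernel [μ.IsAddHaarMeasure] (hD : IsOpen D) (hq : ContinuousOn q D)
    (hq0 : ∀ x ∈ D, 0 < q x) : ∃ K : E → E → ℂ, IsBergmanKernel μ D q K := by
  have hcl := bergmanSubmodule_isClosed (μ := μ) hD hq hq0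
  set H := bergmanSubmodule μ D q with hH
  have : CompleteSpace H := hcl.completeSpace_coe
  have hmem : ∀ F : H, ∃ f : E → ℂ, DifferentiableOn ℂ f D ∧
    (F : Lp ℂ 2 (μ.restrict D)) =ᵐ[μ.restrict D] fun x => f x * (√(q x) : ℂ) := fun F => F.2
  choose rep hrep hrepF using hmem
  -- A holomorphic representative is determined at every point of `D` by its `L²` class, so
  -- evaluation at `y` is a well-defined linear functional, to which Riesz representation applies
  -- once it is bounded.
  have huniq : ∀ y ∈ D, ∀ f : E → ℂ, DifferentiableOn ℂ f D →
      ((fun x => f x * (√(q x) : ℂ)) =ᵐ[μ.restrict D] 0) → f y = 0 := by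
    intro y hy f hf hf0
    obtain ⟨r, hr, -, C, -, hle⟩ := exists_norm_sq_le_setIntegral (μ := μ) hD hq hq0 hy
    have h0 : (0 : Lp ℂ 2 (μ.restrict D)) =ᵐ[μ.restrict D] fun x => f x * (√(q x) : ℂ) :=
      (Lp.coeFn_zero ℂ 2 (μ.restrict D)).trans hf0.symm
    have := hle f (memBergman_of_ae_eq hD hq hq0 hf h0) y (mem_ball_self hr)
    rw [norm_sq_eq_setIntegral hD.measurableSet hq0 h0] at this
    simpa using this
  have hrep_eq : ∀ y ∈ D, ∀ F : H, ∀ f : E → ℂ, DifferentiableOn ℂ f D →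
      (F : Lp ℂ 2 (μ.restrict D)) =ᵐ[μ.restrict D] (fun x => f x * (√(q x) : ℂ)) →
      rep F y = f y := by
    intro y hy F f hf hFf
    refine sub_eq_zero.1 (huniq y hy (fun x => rep F x - f x) ((hrep F).sub hf) ?_)
    filter_upwards [hrepF F, hFf] with x h1 h2
    rw [h1] at h2
    simp [sub_mul, h2]
  have hker : ∀ y ∈ D, ∃ k : H, ∀ F : H, inner ℂ k F = rep F y := by
    intro y hy
    obtain ⟨r, hr, -, C, hC, hle⟩ := exists_norm_sq_le_setIntegral (μ := μ) hD hq hq0 hy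
    let ev : H →ₗ[ℂ] ℂ :=
      { toFun := fun F => rep F y
        map_add' := fun F G => by
          refine hrep_eq y hy (F + G) (fun x => rep F x + rep G x) ((hrep F).add (hrep G)) ?_
          filter_upwards [Lp.coeFn_add (F : Lp ℂ 2 (μ.restrict D)) G, hrepF F, hrepF G]
            with x h1 h2 h3
          rw [Submodule.coe_add, h1, Pi.add_apply, h2, h3, add_mul]
        map_smul' := fun c F => by
          refine hrep_eq y hy (c • F) (fun x => c * rep F x) ((hrep F).const_mul c) ?_
          filter_upwards [Lp.coeFn_smul c (F : Lp ℂ 2 (μ.restrict D)), hrepF F] with x h1 h2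
          rw [Submodule.coe_smul, h1, Pi.smul_apply, h2, smul_eq_mul, mul_assoc] }
    have hb : ∀ F : H, ‖ev F‖ ≤ √C * ‖F‖ := fun F => by
      have := hle _ (memBergman_of_ae_eq hD hq hq0 (hrep F) (hrepF F)) y (mem_ball_self hr)
      rw [norm_sq_eq_setIntegral hD.measurableSet hq0 (hrepF F)] at this
      refine (Real.le_sqrt_of_sq_le this).trans_eq ?_
      rw [Real.sqrt_mul hC.le, Real.sqrt_sq (norm_nonneg _)]
      rfl
    refine ⟨(InnerProductSpace.toDual ℂ H).symm (ev.mkContinuous _ hb), fun F => ?_⟩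
    rw [InnerProductSpace.toDual_symm_apply]
    rfl
  choose! k hk using hker
  refine ⟨fun x y => rep (k y) x, fun y hy =>
    ⟨memBergman_of_ae_eq hD hq hq0 (hrep (k y)) (hrepF (k y)), fun f hf => ?_⟩⟩
  have hfL := ((memBergman_iff_memLp hD hq hq0).1 hf).2
  let F : H := ⟨hfL.toLp _, f, hf.1, hfL.coeFn_toLp⟩
  rw [← hrep_eq y hy F f hf.1 hfL.coeFn_toLp, ← hk y hy F, Submodule.coe_inner, L2.inner_def]
  refine integral_congr_ae ?_
  filter_upwards [hrepF (k y), hfL.coeFn_toLp, ae_restrict_mem hD.measurableSet] with x h1 h2 h3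
  rw [h1, show (F : Lp ℂ 2 (μ.restrict D)) x = _ from h2, RCLike.inner_apply, map_mul,
    Complex.conj_ofReal]
  have : (q x : ℂ) = (√(q x) : ℂ) * (√(q x) : ℂ) := by
    rw [← Complex.ofReal_mul, Real.mul_self_sqrt (hq0 x h3).le]
  rw [this]
  ring

theorem isBergmanKernel_bergmanKernel [μ.IsAddHaarMeasure] (hD : IsOpen D) (hq : ContinuousOn q D)
    (hq0 : ∀ x ∈ D, 0 < q x) : IsBergmanKernel μ D q (bergmanKernel μ D q) := by
  have h := exists_isBergmanKernel (μ := μ) hD hq hq0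
  rw [bergmanKernel, dif_pos h]
  exact h.choose_spec

end BergmanSpace

/-! ### Normalised volume and Gaussian reproducing formulas -/

section Gaussian

open Metric Filter Module

theorem setOf_norm_sq_lt_eq_ball {W : Type*} [SeminormedAddCommGroup W] (s : ℝ) : {Z : W | ‖Z‖ ^ 2 < s} = ball 0 √s := by
  ext Z; simp [Real.lt_sqrt (norm_nonneg Z)]

variable {W : Type*} [NormedAddCommGroup W] [InnerProductSpace ℂ W]
  [FiniteDimensional ℂ W] [MeasurableSpace W] [BorelSpace W]

instance hermitianVolume_isAddHaarMeasure : (hermitianVolume W).IsAddHaarMeasure := by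
  let : InnerProductSpace ℝ W := InnerProductSpace.rclikeToReal ℂ W
  have : FiniteDimensional ℝ W := FiniteDimensional.complexToReal W
  exact Measure.IsAddHaarMeasure.smul _ (by simp; positivity) ENNReal.ofReal_ne_top

/-- The factor `n! / π^n` is the reciprocal of the Euclidean volume of the unit ball; this is why
only binomial coefficients survive in the kernel expansion. -/
theorem hermitianVolume_ball_zero_one [Nontrivial W] :
    hermitianVolume W (ball 0 1) = 1 := by
  let : InnerProductSpace ℝ W := InnerProductSpace.rclikeToReal ℂ W
  have : FiniteDimensional ℝ W := FiniteDimensional.complexToReal W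
  have h := InnerProductSpace.volume_ball_of_dim_even (E := W) (finrank_real_of_complex W) 0 1
  rw [hermitianVolume, Measure.smul_apply, h, ENNReal.ofReal_one, one_pow, one_mul, smul_eq_mul,
    ← ENNReal.ofReal_mul (by positivity), div_mul_div_comm, mul_comm, div_self (by positivity),
    ENNReal.ofReal_one]

theorem hermitianVolume_setOf_norm_sq_lt [Nontrivial W] {s : ℝ} (hs : 0 < s) :
    hermitianVolume W {Z | ‖Z‖ ^ 2 < s} = ENNReal.ofReal (s ^ finrank ℂ W) := by
  have : FiniteDimensional ℝ W := FiniteDimensional.complexToReal W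
  rw [setOf_norm_sq_lt_eq_ball, Measure.addHaar_ball_of_pos _ _ (Real.sqrt_pos.2 hs), hermitianVolume_ball_zero_one,
    mul_one, finrank_real_of_complex, pow_mul, Real.sq_sqrt hs.le]

/-- Powers times exponentials of the norm are integrable against the Gaussian weight. -/
theorem integrable_norm_pow_mul_exp_sub_sq (μ : Measure W) [μ.IsAddHaarMeasure] (k : ℕ) (a : ℝ) :
    Integrable (fun Z : W => ‖Z‖ ^ k * Real.exp (a * ‖Z‖ - ‖Z‖ ^ 2)) μ := by
  have : FiniteDimensional ℝ W := FiniteDimensional.complexToReal W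
  set N := finrank ℝ W + 1 with hN
  have h := integrable_one_add_norm (E := W) (μ := μ) (r := N) (by simp [hN])
  -- Comparison with `(1 + u)^(-N)`, `u = ‖Z‖`. The powers `u^k` and `(1 + u)^N` cost factors `k!
  -- e^u` and `N! e^(1+u)`; completing the square then bounds the exponent `1 + (a + 2) u - u²`.
  refine (h.const_mul (k.factorial * N.factorial * Real.exp (1 + (a + 2) ^ 2 / 4))).mono'
    (by fun_prop) (Eventually.of_forall fun Z => ?_)
  set u := ‖Z‖ with hu
  have hu0 : 0 ≤ u := norm_nonneg Z
  rw [Real.norm_of_nonneg (by positivity), Real.rpow_neg (by positivity), Real.rpow_natCast,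
    ← div_eq_mul_inv, le_div_iff₀ (by positivity)]
  have h1 : u ^ k ≤ k.factorial * Real.exp u := by
    have := Real.pow_div_factorial_le_exp u hu0 k
    rwa [div_le_iff₀' (by positivity)] at this
  have h2 : (1 + u) ^ N ≤ N.factorial * Real.exp (1 + u) := by
    have := Real.pow_div_factorial_le_exp (1 + u) (by positivity) N
    rwa [div_le_iff₀' (by positivity)] at this
  calc u ^ k * Real.exp (a * u - u ^ 2) * (1 + u) ^ N
      ≤ (k.factorial * Real.exp u) * Real.exp (a * u - u ^ 2) *
        (N.factorial * Real.exp (1 + u)) := by gcongr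
    _ = k.factorial * N.factorial * Real.exp (u + (a * u - u ^ 2) + (1 + u)) := by
        rw [Real.exp_add (u + (a * u - u ^ 2)), Real.exp_add u]; ring
    _ ≤ _ := by
        refine mul_le_mul_of_nonneg_left (Real.exp_le_exp.2 ?_) (by positivity)
        nlinarith [sq_nonneg (u - (a + 2) / 2)]

theorem integrable_mul_cexp_inner_sub_norm_sq (μ : Measure W) [μ.IsAddHaarMeasure] {h : W → ℂ}
    (hh : Continuous h) {M : ℝ} {k : ℕ} (hM : ∀ Z, ‖h Z‖ ≤ M * ‖Z‖ ^ k) (w : W) :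
    Integrable (fun Z => h Z * Complex.exp (inner ℂ Z w - (‖Z‖ ^ 2 : ℝ))) μ := by
  have : ProperSpace W := FiniteDimensional.proper ℂ W
  refine ((integrable_norm_pow_mul_exp_sub_sq μ k ‖w‖).const_mul M).mono'
    (hh.mul (by fun_prop)).aestronglyMeasurable (Eventually.of_forall fun Z => ?_)
  rw [norm_mul, Complex.norm_exp, ← mul_assoc]
  refine mul_le_mul (hM Z) (Real.exp_le_exp.2 ?_) (by positivity)
    ((norm_nonneg _).trans (hM Z))
  have h1 : (inner ℂ Z w).re ≤ ‖Z‖ * ‖w‖ := re_inner_le_norm (𝕜 := ℂ) Z w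
  simp only [Complex.sub_re, Complex.ofReal_re]
  linarith

/-- The Gaussian reproducing formula (Bargmann–Fock). -/
theorem integral_mul_cexp_inner_sub_norm_sq (μ : Measure W) [μ.IsAddHaarMeasure] {h : W → ℂ}
    (hh : Differentiable ℂ h) {M : ℝ} {k : ℕ} (hM : ∀ Z, ‖h Z‖ ≤ M * ‖Z‖ ^ k) (w : W) :
    ∫ Z, h Z * Complex.exp (inner ℂ Z w - (‖Z‖ ^ 2 : ℝ)) ∂μ =
      h w * ∫ Z : W, ((Real.exp (-‖Z‖ ^ 2) : ℝ) : ℂ) ∂μ := by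
  have : ProperSpace W := FiniteDimensional.proper ℂ W
  have hint := integrable_mul_cexp_inner_sub_norm_sq μ hh.continuous hM w
  -- After the shift `Z ↦ Z + w` the antiholomorphic terms of the exponent cancel, leaving `-‖Z‖² -
  -- ⟨w, Z⟩`. The integrand is a rotation invariant Gaussian times the entire function `G`, whose
  -- circle averages all equal `G 0 = h w`.
  set G : W → ℂ := fun Z => h (Z + w) * Complex.exp (-inner ℂ w Z) with hG
  have hGd : Differentiable ℂ G :=
    (hh.comp (differentiable_id.add_const w)).mul
      ((innerSL ℂ w).differentiable.neg.cexp)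
  have hshift : ∀ Z, h (Z + w) * Complex.exp (inner ℂ (Z + w) w - (‖Z + w‖ ^ 2 : ℝ)) =
      ((Real.exp (-‖Z‖ ^ 2) : ℝ) : ℂ) * G Z := by
    intro Z
    have e1 : inner ℂ (Z + w) w - ((‖Z + w‖ ^ 2 : ℝ) : ℂ) =
        ((-‖Z‖ ^ 2 : ℝ) : ℂ) + -inner ℂ w Z := by
      have e2 : ((‖Z + w‖ ^ 2 : ℝ) : ℂ) = inner ℂ (Z + w) (Z + w) := by
        rw [inner_self_eq_norm_sq_to_K]; norm_cast
      have e3 : ((-‖Z‖ ^ 2 : ℝ) : ℂ) = -inner ℂ Z Z := by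
        rw [inner_self_eq_norm_sq_to_K]; push_cast; rfl
      rw [e2, e3, inner_add_left, inner_add_left, inner_add_right, inner_add_right]
      ring
    rw [e1, Complex.exp_add, hG, Complex.ofReal_exp]
    ring
  rw [← integral_add_right_eq_self _ w]
  simp only [hshift]
  have hint2 : Integrable (fun Z => ((Real.exp (-‖Z‖ ^ 2) : ℝ) : ℂ) * G Z) μ := by
    have := hint.comp_add_right w
    simpa only [hshift] using this
  rw [← (isCircleInvariant_of_isAddHaarMeasure μ).integral_circleAverage hint2,
    ← integral_const_mul]
  refine integral_congr_ae (Eventually.of_forall fun Z => ?_)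
  have e1 : Real.circleAverage
      (fun t => ((Real.exp (-‖t • Z‖ ^ 2) : ℝ) : ℂ) * G (t • Z)) 0 1 =
      Real.circleAverage (fun t => ((Real.exp (-‖Z‖ ^ 2) : ℝ) : ℂ) • G (t • Z)) 0 1 := by
    refine Real.circleAverage_congr_sphere fun t ht => ?_
    have : ‖t‖ = 1 := by simpa using ht
    simp [norm_smul, this]
  have hl : Differentiable ℂ fun t : ℂ => G (t • Z) := hGd.comp (by fun_prop)
  simp only [e1]
  rw [Real.circleAverage_fun_smul, DiffContOnCl.circleAverage hl.diffContOnCl]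
  simp [hG, mul_comm]

theorem circleAverage_pow_mul_conj_cexp (k : ℕ) (a : ℂ) :
    Real.circleAverage (fun t => t ^ k * conj (Complex.exp (a * t))) 0 1 =
      (k.factorial : ℂ)⁻¹ * conj a ^ k := by
  have hd : Differentiable ℂ fun t : ℂ => Complex.exp (a * t) := by fun_prop
  have h := circleAverage_conj_pow_mul hd.diffContOnCl k
  rw [iteratedDeriv_cexp_const_mul] at h
  have h2 := congrArg conj h
  simp only [mul_zero, Complex.exp_zero, mul_one, map_mul, map_inv₀, map_natCast, map_pow] at h2
  rw [← h2, Real.circleAverage_def, Real.circleAverage_def, ← Complex.conjCLE_apply, map_smul,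
    Complex.conjCLE_apply, intervalIntegral.integral_of_le Real.two_pi_pos.le,
    intervalIntegral.integral_of_le Real.two_pi_pos.le, ← integral_conj]
  simp

/-- The Gaussian reproducing formula for homogeneous holomorphic functions. -/
theorem integral_mul_conj_inner_pow_mul_exp (μ : Measure W) [μ.IsAddHaarMeasure] {h : W → ℂ}
    (hh : Differentiable ℂ h) {M : ℝ} {k : ℕ} (hM : ∀ Z, ‖h Z‖ ≤ M * ‖Z‖ ^ k)
    (hk : ∀ (t : ℂ) (Z : W), h (t • Z) = t ^ k * h Z) (w : W) :
    ∫ Z, h Z * conj (inner ℂ w Z) ^ k * ((Real.exp (-‖Z‖ ^ 2) : ℝ) : ℂ) ∂μ =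
      k.factorial * h w * ∫ Z : W, ((Real.exp (-‖Z‖ ^ 2) : ℝ) : ℂ) ∂μ := by
  have : ProperSpace W := FiniteDimensional.proper ℂ W
  have hint := integrable_mul_cexp_inner_sub_norm_sq μ hh.continuous hM w
  rw [mul_assoc, ← integral_mul_cexp_inner_sub_norm_sq μ hh hM w,
    ← (isCircleInvariant_of_isAddHaarMeasure μ).integral_circleAverage hint,
    ← integral_const_mul]
  refine integral_congr_ae (Eventually.of_forall fun Z => ?_)
  -- As `h` has degree `k`, averaging over `t` retains only the term of degree `k` in the expansion
  -- of the exponential of the inner product; this produces the `1 / k!`.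
  have e1 : Real.circleAverage
      (fun t => h (t • Z) * Complex.exp (inner ℂ (t • Z) w - (‖t • Z‖ ^ 2 : ℝ))) 0 1 =
      Real.circleAverage (fun t => (h Z * ((Real.exp (-‖Z‖ ^ 2) : ℝ) : ℂ)) •
        (t ^ k * conj (Complex.exp (inner ℂ w Z * t)))) 0 1 := by
    refine Real.circleAverage_congr_sphere fun t ht => ?_
    have ht1 : ‖t‖ = 1 := by simpa using ht
    simp only [hk, norm_smul, ht1, one_mul, inner_smul_left, sub_eq_add_neg, Complex.exp_add,
      smul_eq_mul, ← Complex.exp_conj, map_mul, inner_conj_symm, Complex.ofReal_exp,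
      Complex.ofReal_neg]
    ring_nf
  simp only [e1]
  rw [Real.circleAverage_fun_smul, circleAverage_pow_mul_conj_cexp, smul_eq_mul]
  have : (k.factorial : ℂ) ≠ 0 := by exact_mod_cast k.factorial_ne_zero
  field_simp

end Gaussian

/-! ### Homogeneous parts and their extraction by integration over balls -/

section HomogeneousParts

open Metric Filter Module

/-- The homogeneous part of degree `k` at `Z` of a function holomorphic near the origin. -/
noncomputable def homogeneousPart {W : Type*} [AddCommGroup W] [Module ℂ W] (g : W → ℂ) (k : ℕ) (Z : W) : ℂ :=
  (k.factorial : ℂ)⁻¹ * iteratedDeriv k (fun t : ℂ => g (t • Z)) 0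

section Normed

variable {W : Type*} [NormedAddCommGroup W] [NormedSpace ℂ W] {g : W → ℂ} {r : ℝ}

theorem diffContOnCl_comp_smul (hg : DifferentiableOn ℂ g (ball 0 r)) {Z : W}
    (hZ : Z ∈ ball (0 : W) r) : DiffContOnCl ℂ (fun t : ℂ => g (t • Z)) (ball 0 1) := by
  refine DifferentiableOn.diffContOnCl (hg.comp (s := closure (ball 0 1)) (by fun_prop)
    fun t ht => ?_)
  rw [closure_ball _ one_ne_zero] at ht
  simp only [mem_closedBall, dist_zero_right, norm_smul, mem_ball] at ht hZ ⊢
  nlinarith [norm_nonneg Z, norm_nonneg t]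

/-- This is the one-variable Taylor series of `t ↦ g (t • Z)` at `t = 1`, which lies inside a disc
of holomorphy of radius greater than 1. -/
theorem hasSum_homogeneousPart (hg : DifferentiableOn ℂ g (ball 0 r)) {Z : W}
    (hZ : Z ∈ ball (0 : W) r) : HasSum (fun k => homogeneousPart g k Z) (g Z) := by
  obtain ⟨s, hs1, hs⟩ : ∃ s : ℝ, 1 < s ∧ s * ‖Z‖ < r := by
    have : ∀ᶠ s in 𝓝 (1 : ℝ), s * ‖Z‖ < r :=
      (continuous_id.mul continuous_const).continuousAt.eventually
        (gt_mem_nhds (by simpa using hZ))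
    obtain ⟨ε, hε, h⟩ := Metric.eventually_nhds_iff_ball.1 this
    exact ⟨1 + ε / 2, by linarith, h _ (by simp [abs_of_pos hε, hε])⟩
  have hd : DifferentiableOn ℂ (fun t : ℂ => g (t • Z)) (ball 0 s) :=
    hg.comp (by fun_prop) fun t ht => by
      simp only [dist_zero_right, norm_smul, mem_ball] at ht ⊢
      nlinarith [norm_nonneg Z, norm_nonneg t]
  have := Complex.hasSum_taylorSeries_on_ball hd (z := 1) (by simpa using hs1)
  simpa [homogeneousPart] using this

/-- Chain rule along the line through `Z`. The condition `‖a‖ ≤ 1` makes multiplication by `a` map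
the disc `s` of admissible parameters into itself; larger `a` are reached through `a⁻¹`. -/
theorem homogeneousPart_smul_of_norm_le_one (hr : 0 < r) (hg : DifferentiableOn ℂ g (ball 0 r))
    (k : ℕ) {a : ℂ} (ha : ‖a‖ ≤ 1) (Z : W) :
    homogeneousPart g k (a • Z) = a ^ k * homogeneousPart g k Z := by
  set s : Set ℂ := {t | t • Z ∈ ball (0 : W) r} with hs
  have hso : IsOpen s := isOpen_ball.preimage (by fun_prop)
  have h0 : (0 : ℂ) ∈ s := by simp [hs, hr]
  have hd : DifferentiableOn ℂ (fun t : ℂ => g (t • Z)) s := hg.comp (by fun_prop) fun t ht => ht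
  have hmaps : Set.MapsTo (a * ·) s s := fun t ht => by
    simp only [hs, Set.mem_ofPred_eq, mem_ball, dist_zero_right, norm_smul, norm_mul] at ht ⊢
    refine lt_of_le_of_lt ?_ ht
    have : ‖a‖ * ‖t‖ ≤ ‖t‖ := mul_le_of_le_one_left (norm_nonneg _) ha
    gcongr
  have h := iteratedDerivWithin_comp_const_smul h0 hso.uniqueDiffOn (hd.contDiffOn (n := k) hso)
    a hmaps
  rw [iteratedDerivWithin_of_isOpen hso h0, mul_zero, iteratedDerivWithin_of_isOpen hso h0] at h
  simp only [homogeneousPart, smul_smul, mul_comm _ a, h, smul_eq_mul]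
  ring

theorem homogeneousPart_smul (hr : 0 < r) (hg : DifferentiableOn ℂ g (ball 0 r))
    (k : ℕ) (a : ℂ) (Z : W) :
    homogeneousPart g k (a • Z) = a ^ k * homogeneousPart g k Z := by
  rcases le_total ‖a‖ 1 with ha | ha
  · exact homogeneousPart_smul_of_norm_le_one hr hg k ha Z
  · have ha0 : a ≠ 0 := fun h => by norm_num [h] at ha
    have h := homogeneousPart_smul_of_norm_le_one hr hg k
      (a := a⁻¹) (by rw [norm_inv]; exact inv_le_one_of_one_le₀ ha) (a • Z)
    rw [smul_smul, inv_mul_cancel₀ ha0, one_smul] at h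
    rw [h, ← mul_assoc, ← mul_pow, mul_inv_cancel₀ ha0, one_pow, one_mul]

theorem differentiable_homogeneousPart [FiniteDimensional ℂ W] (hr : 0 < r)
    (hg : DifferentiableOn ℂ g (ball 0 r)) (k : ℕ) : Differentiable ℂ (homogeneousPart g k) := by
  have h := differentiableOn_iteratedDeriv_snd (E := W)
    (U := (fun x : W × ℂ => x.2 • x.1) ⁻¹' ball 0 r) (isOpen_ball.preimage (by fun_prop))
    (g := fun x => g (x.2 • x.1)) (hg.comp (by fun_prop) fun x hx => hx) k
  -- The derivative at `t = 0` sees only small multiples of `x`, so the homogeneous part is entire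
  -- although `g` is controlled only on a ball.
  have huniv : {x : W | (x, (0 : ℂ)) ∈ (fun x : W × ℂ => x.2 • x.1) ⁻¹' ball 0 r} = Set.univ := by
    ext x; simp [hr]
  rw [huniv, differentiableOn_univ] at h
  exact h.const_mul _

theorem exists_norm_homogeneousPart_le [FiniteDimensional ℂ W] (hr : 0 < r)
    (hg : DifferentiableOn ℂ g (ball 0 r)) (k : ℕ) :
    ∃ M, ∀ Z, ‖homogeneousPart g k Z‖ ≤ M * ‖Z‖ ^ k := by
  have : ProperSpace W := FiniteDimensional.proper ℂ W
  obtain ⟨M, hM⟩ := (isCompact_closedBall (0 : W) 1).exists_bound_of_continuousOn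
    (differentiable_homogeneousPart hr hg k).continuous.continuousOn
  refine ⟨M, fun Z => ?_⟩
  -- For `Z = 0` this gives `u = 0`, hence the bound `‖u‖ ≤ 1` in place of an equality.
  set u : W := ((‖Z‖⁻¹ : ℝ) : ℂ) • Z with hu
  have hZ : Z = ((‖Z‖ : ℝ) : ℂ) • u := by
    rcases eq_or_ne Z 0 with rfl | h
    · simp
    · rw [hu, smul_smul, ← Complex.ofReal_mul, mul_inv_cancel₀ (norm_ne_zero_iff.2 h),
        Complex.ofReal_one, one_smul]
  have hu1 : ‖u‖ ≤ 1 := by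
    rw [hu, norm_smul, Complex.norm_real, norm_inv, norm_norm]
    exact inv_mul_le_one
  conv_lhs => rw [hZ, homogeneousPart_smul hr hg k, norm_mul, norm_pow, Complex.norm_real,
    norm_norm, mul_comm]
  gcongr
  exact hM u (by simpa using hu1)

end Normed

variable {W : Type*} [NormedAddCommGroup W] [InnerProductSpace ℂ W]
  [FiniteDimensional ℂ W] [MeasurableSpace W] [BorelSpace W]

/-- Scaling of the integral of a real homogeneous function over a ball. -/
theorem setIntegral_norm_sq_lt_of_homogeneous (μ : Measure W) [μ.IsAddHaarMeasure] {φ : W → ℂ}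
    {k : ℕ} (hφ : ∀ (c : ℝ) (Z : W), 0 < c → φ (c • Z) = ((c ^ (2 * k) : ℝ) : ℂ) * φ Z)
    {s : ℝ} (hs : 0 < s) :
    ∫ Z in {Z : W | ‖Z‖ ^ 2 < s}, φ Z ∂μ =
      ((s ^ (k + finrank ℂ W) : ℝ) : ℂ) * ∫ Z in ball (0 : W) 1, φ Z ∂μ := by
  have : FiniteDimensional ℝ W := FiniteDimensional.complexToReal W
  have hs' : 0 < √s := Real.sqrt_pos.2 hs
  have h := Measure.setIntegral_comp_smul_of_pos μ φ (ball (0 : W) 1) hs'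
  rw [smul_unitBall hs'.ne', Real.norm_of_nonneg hs'.le, finrank_real_of_complex, pow_mul,
    Real.sq_sqrt hs.le] at h
  simp only [fun Z => hφ √s Z hs', pow_mul, Real.sq_sqrt hs.le, integral_const_mul] at h
  rw [setOf_norm_sq_lt_eq_ball, pow_add, Complex.ofReal_mul, mul_right_comm, h, ← Complex.coe_smul,
    smul_eq_mul, Complex.ofReal_inv]
  have : ((s ^ finrank ℂ W : ℝ) : ℂ) ≠ 0 := by exact_mod_cast (pow_pos hs _).ne'
  field_simp

/-- Gaussian integral of a homogeneous function in terms of its integral over the unit ball. -/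
theorem integral_mul_exp_neg_norm_sq_of_homogeneous (μ : Measure W) [μ.IsAddHaarMeasure]
    {φ : W → ℂ} (hc : Continuous φ)
    {k : ℕ} (hφ : ∀ (c : ℝ) (Z : W), 0 < c → φ (c • Z) = ((c ^ (2 * k) : ℝ) : ℂ) * φ Z)
    {M : ℝ} (hM : ∀ Z, ‖φ Z‖ ≤ M * ‖Z‖ ^ (2 * k)) :
    ∫ Z, φ Z * ((Real.exp (-‖Z‖ ^ 2) : ℝ) : ℂ) ∂μ =
      (k + finrank ℂ W).factorial * ∫ Z in ball (0 : W) 1, φ Z ∂μ := by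
  have : ProperSpace W := FiniteDimensional.proper ℂ W
  -- Write `exp(-‖Z‖²)` as the integral of `exp(-s)` over `s > ‖Z‖²` and exchange integrals: the
  -- ball `‖Z‖² < s` contributes `s^(k + dim)`, and the remaining Gamma integral is the factorial.
  set τ : Measure ℝ := volume.restrict (Set.Ioi 0) with hτ
  set S : Set (W × ℝ) := {p | ‖p.1‖ ^ 2 < p.2} with hS
  have hSm : MeasurableSet S := measurableSet_lt (by fun_prop) (by fun_prop)
  set Φ : W → ℝ → ℂ := fun Z s => S.indicator (fun p => φ p.1 * ((Real.exp (-p.2) : ℝ) : ℂ)) (Z, s)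
    with hΦ
  have hΦ1 : ∀ Z, Φ Z = (Set.Ioi (‖Z‖ ^ 2)).indicator
      (fun s => φ Z * ((Real.exp (-s) : ℝ) : ℂ)) := fun Z => by
    ext s; simp [hΦ, hS, Set.indicator_apply]
  have hΦ2 : ∀ s, (fun Z => Φ Z s) = {Z : W | ‖Z‖ ^ 2 < s}.indicator
      (fun Z => φ Z * ((Real.exp (-s) : ℝ) : ℂ)) := fun s => by
    ext Z; simp [hΦ, hS, Set.indicator_apply]
  have hsub : ∀ Z : W, Set.Ioi (‖Z‖ ^ 2) ∩ Set.Ioi 0 = Set.Ioi (‖Z‖ ^ 2) := fun Z =>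
    Set.inter_eq_left.2 (Set.Ioi_subset_Ioi (by positivity))
  have hexp : ∀ Z : W, IntegrableOn (fun s => ((Real.exp (-s) : ℝ) : ℂ)) (Set.Ioi (‖Z‖ ^ 2)) :=
    fun Z => (integrableOn_exp_neg_Ioi _).ofReal
  have hint : Integrable (Function.uncurry Φ) (μ.prod τ) := by
    have hm : AEStronglyMeasurable (Function.uncurry Φ) (μ.prod τ) :=
      AEStronglyMeasurable.indicator (f := fun p : W × ℝ => φ p.1 * ((Real.exp (-p.2) : ℝ) : ℂ))
        (Continuous.aestronglyMeasurable (by fun_prop)) hSm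
    refine (integrable_prod_iff hm).2 ⟨Eventually.of_forall fun Z => ?_, ?_⟩
    · simp only [Function.uncurry_apply_pair]
      rw [hΦ1, integrable_indicator_iff measurableSet_Ioi, IntegrableOn,
        hτ, Measure.restrict_restrict measurableSet_Ioi, hsub]
      exact (hexp Z).const_mul _
    · have e : ∀ Z, ∫ s, ‖Function.uncurry Φ (Z, s)‖ ∂τ = ‖φ Z‖ * Real.exp (-‖Z‖ ^ 2) := fun Z => by
        simp only [Function.uncurry_apply_pair]
        simp only [hΦ1, norm_indicator_eq_indicator_norm]
        rw [integral_indicator measurableSet_Ioi, hτ, Measure.restrict_restrict measurableSet_Ioi,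
          hsub]
        simp only [norm_mul, Complex.norm_real, Real.norm_of_nonneg (Real.exp_pos _).le]
        rw [integral_const_mul, integral_exp_neg_Ioi]
      simp only [e]
      refine ((integrable_norm_pow_mul_exp_sub_sq μ (2 * k) 0).const_mul M).mono'
        (by fun_prop) (Eventually.of_forall fun Z => ?_)
      rw [Real.norm_of_nonneg (by positivity), ← mul_assoc, zero_mul, zero_sub]
      gcongr
      exact hM Z
  have hswap := integral_integral_swap hint
  have e1 : ∀ Z, ∫ s, Φ Z s ∂τ = φ Z * ((Real.exp (-‖Z‖ ^ 2) : ℝ) : ℂ) := fun Z => by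
    rw [hΦ1, integral_indicator measurableSet_Ioi, hτ,
      Measure.restrict_restrict measurableSet_Ioi, hsub, integral_const_mul,
      integral_complex_ofReal, integral_exp_neg_Ioi]
  have e2 : ∫ s, ∫ Z, Φ Z s ∂μ ∂τ = ∫ s, ((Real.exp (-s) * s ^ (k + finrank ℂ W) : ℝ) : ℂ) *
      ∫ Z in ball (0 : W) 1, φ Z ∂μ ∂τ := by
    refine setIntegral_congr_fun measurableSet_Ioi fun s hs => ?_
    rw [hΦ2, integral_indicator (measurableSet_lt (by fun_prop) (by fun_prop)), integral_mul_const,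
      setIntegral_norm_sq_lt_of_homogeneous μ hφ hs]
    push_cast
    ring
  simp only [e1] at hswap
  rw [hswap, e2, integral_mul_const, integral_complex_ofReal]
  congr 1
  have := Real.Gamma_eq_integral (s := (k + finrank ℂ W : ℕ) + 1) (by positivity)
  rw [Real.Gamma_nat_eq_factorial] at this
  rw [← Complex.ofReal_natCast, this]
  congr 1
  refine setIntegral_congr_fun measurableSet_Ioi fun s hs => ?_
  simp only [add_sub_cancel_right, Real.rpow_natCast]

/-- Integration over a ball against `conj ⟨Z, w⟩ ^ k` picks out the homogeneous part of
degree `k`. -/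
theorem setIntegral_mul_conj_inner_pow [Nontrivial W] {s : ℝ} (hs : 0 < s) {g : W → ℂ}
    (hg : DifferentiableOn ℂ g {Z | ‖Z‖ ^ 2 < s})
    (hint : IntegrableOn g {Z | ‖Z‖ ^ 2 < s} (hermitianVolume W)) (k : ℕ) (w : W) :
    ((k + finrank ℂ W).choose (finrank ℂ W) : ℂ) *
      ∫ Z in {Z | ‖Z‖ ^ 2 < s}, g Z * conj (inner ℂ w Z) ^ k ∂(hermitianVolume W) =
      ((s ^ (k + finrank ℂ W) : ℝ) : ℂ) * homogeneousPart g k w := by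
  have : ProperSpace W := FiniteDimensional.proper ℂ W
  set ν := hermitianVolume W with hν
  set d := finrank ℂ W with hd
  rw [setOf_norm_sq_lt_eq_ball] at hg hint ⊢
  have hs' : 0 < √s := Real.sqrt_pos.2 hs
  set h := homogeneousPart g k with hh
  obtain ⟨M, hM⟩ := exists_norm_homogeneousPart_le hs' hg k
  have hhd := differentiable_homogeneousPart hs' hg k
  have hint2 : IntegrableOn (fun Z => g Z * conj (inner ℂ w Z) ^ k) (ball 0 √s) ν := by
    refine Integrable.mul_bdd (c := (‖w‖ * √s) ^ k) hint
      (Continuous.aestronglyMeasurable (by fun_prop)) ?_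
    filter_upwards [ae_restrict_mem measurableSet_ball] with Z hZ
    rw [norm_pow, RCLike.norm_conj]
    have h1 := norm_inner_le_norm (𝕜 := ℂ) w Z
    have h2 : ‖Z‖ ≤ √s := (mem_ball_zero_iff.1 hZ).le
    gcongr
    exact h1.trans (by gcongr)
  have hinv : IsCircleInvariant (ν.restrict (ball (0 : W) √s)) :=
    (isCircleInvariant_of_isAddHaarMeasure ν).restrict measurableSet_ball
      fun a ha x => by simp [norm_smul, ha]
  -- Averaging over circles replaces `g` by its part of degree `k`, so only homogeneous integrands
  -- remain.
  have havg : ∫ Z in ball 0 √s, g Z * conj (inner ℂ w Z) ^ k ∂ν =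
      ∫ Z in ball 0 √s, h Z * conj (inner ℂ w Z) ^ k ∂ν := by
    rw [← hinv.integral_circleAverage hint2]
    refine integral_congr_ae ?_
    filter_upwards [ae_restrict_mem measurableSet_ball] with Z hZ
    have e : (fun t : ℂ => g (t • Z) * conj (inner ℂ w (t • Z)) ^ k) = fun t =>
        (conj (inner ℂ w Z) ^ k) • (conj t ^ k * g (t • Z)) := by
      ext t
      simp only [inner_smul_right, map_mul, mul_pow, smul_eq_mul]
      ring
    rw [e, Real.circleAverage_fun_smul,
      circleAverage_conj_pow_mul (diffContOnCl_comp_smul hg hZ), smul_eq_mul, mul_comm]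
    rfl
  have hhk : ∀ (t : ℂ) (Z : W), h (t • Z) = t ^ k * h Z := homogeneousPart_smul hs' hg k
  have hφ : ∀ (c : ℝ) (Z : W), 0 < c → h (c • Z) * conj (inner ℂ w (c • Z)) ^ k =
      ((c ^ (2 * k) : ℝ) : ℂ) * (h Z * conj (inner ℂ w Z) ^ k) := by
    intro c Z _
    rw [← Complex.coe_smul, hhk, inner_smul_right, map_mul, Complex.conj_ofReal]
    push_cast
    ring
  have hφM : ∀ Z, ‖h Z * conj (inner ℂ w Z) ^ k‖ ≤ M * ‖w‖ ^ k * ‖Z‖ ^ (2 * k) := by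
    intro Z
    rw [norm_mul, norm_pow, RCLike.norm_conj]
    calc ‖h Z‖ * ‖inner ℂ w Z‖ ^ k ≤ (M * ‖Z‖ ^ k) * (‖w‖ * ‖Z‖) ^ k :=
          mul_le_mul (hM Z) (pow_le_pow_left₀ (norm_nonneg _) (norm_inner_le_norm w Z) k)
            (by positivity) ((norm_nonneg _).trans (hM Z))
      _ = _ := by ring
  have hφc : Continuous fun Z => h Z * conj (inner ℂ w Z) ^ k :=
    hhd.continuous.mul (by fun_prop)
  -- Two evaluations of one Gaussian integral: `(k + d)!` times the unit ball integral equals `k!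
  -- h(w)` times the total Gaussian mass. The case `φ = 1` shows that this mass is `d!`.
  have h1 := integral_mul_exp_neg_norm_sq_of_homogeneous ν hφc hφ hφM
  rw [integral_mul_conj_inner_pow_mul_exp ν hhd hM hhk w] at h1
  have h0 := integral_mul_exp_neg_norm_sq_of_homogeneous ν (φ := fun _ => 1) continuous_const
    (k := 0) (by simp) (M := 1) (by simp)
  have hν1 : ν.real (ball 0 1) = 1 := by
    rw [measureReal_def, hermitianVolume_ball_zero_one, ENNReal.toReal_one]
  simp only [one_mul, zero_add, setIntegral_const, hν1, one_smul, mul_one] at h0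
  rw [h0] at h1
  rw [havg, ← setOf_norm_sq_lt_eq_ball, setIntegral_norm_sq_lt_of_homogeneous ν hφ hs,
    mul_left_comm]
  congr 1
  have hfac : ((k + d).choose d : ℂ) * (k.factorial * d.factorial) = (k + d).factorial := by
    have := Nat.add_choose_mul_factorial_mul_factorial k d
    rw [mul_assoc] at this
    exact_mod_cast this
  have hk0 : (k.factorial * d.factorial : ℂ) ≠ 0 := by
    exact_mod_cast mul_ne_zero k.factorial_ne_zero d.factorial_ne_zero
  refine mul_left_cancel₀ hk0 ?_
  rw [← mul_assoc, mul_comm _ ((k + d).choose d : ℂ), hfac, ← h1]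
  ring

end HomogeneousParts

/-! ### Fubini for sets fibred over a base -/

section Slices

open Filter

variable {α β F : Type*} [NormedAddCommGroup F] {A : Set α} {T : α → Set β}

theorem indicator_setOf_mem_and_mem (f : α × β → F) (a : α) :
    (fun b => {x : α × β | x.1 ∈ A ∧ x.2 ∈ T x.1}.indicator f (a, b)) =
      A.indicator (fun a => (T a).indicator fun b => f (a, b)) a := by
  classical
  ext b
  by_cases ha : a ∈ A <;> simp [Set.indicator_apply, ha]

variable [MeasurableSpace α] [MeasurableSpace β] {μ : Measure α} {ν : Measure β}

theorem ae_integrableOn_slice [SFinite μ] [SFinite ν]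
    (hA : MeasurableSet A) (hT : ∀ a, MeasurableSet (T a))
    (hD : MeasurableSet {x : α × β | x.1 ∈ A ∧ x.2 ∈ T x.1})
    {f : α × β → F}
    (hf : IntegrableOn f {x | x.1 ∈ A ∧ x.2 ∈ T x.1} (μ.prod ν)) :
    ∀ᵐ a ∂μ.restrict A, IntegrableOn (fun b => f (a, b)) (T a) ν := by
  rw [← integrable_indicator_iff hD] at hf
  rw [ae_restrict_iff' hA]
  filter_upwards [hf.prod_right_ae] with a ha haA
  rw [indicator_setOf_mem_and_mem, Set.indicator_of_mem haA, integrable_indicator_iff (hT a)] at ha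
  exact ha

theorem setIntegral_slice [SFinite μ] [SFinite ν] [NormedSpace ℝ F]
    (hA : MeasurableSet A) (hT : ∀ a, MeasurableSet (T a))
    (hD : MeasurableSet {x : α × β | x.1 ∈ A ∧ x.2 ∈ T x.1})
    {f : α × β → F}
    (hf : IntegrableOn f {x | x.1 ∈ A ∧ x.2 ∈ T x.1} (μ.prod ν)) :
    ∫ x in {x | x.1 ∈ A ∧ x.2 ∈ T x.1}, f x ∂(μ.prod ν) =
      ∫ a in A, ∫ b in T a, f (a, b) ∂ν ∂μ := by
  rw [← integral_indicator hD, integral_prod _ ((integrable_indicator_iff hD).2 hf),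
    ← integral_indicator hA]
  congr 1
  ext a
  rw [indicator_setOf_mem_and_mem]
  by_cases ha : a ∈ A
  · rw [Set.indicator_of_mem ha, Set.indicator_of_mem ha, integral_indicator (hT a)]
  · simp [Set.indicator_of_notMem ha]

theorem integrableOn_integral_slice [SFinite μ] [SFinite ν] [NormedSpace ℝ F]
    (hA : MeasurableSet A) (hT : ∀ a, MeasurableSet (T a))
    (hD : MeasurableSet {x : α × β | x.1 ∈ A ∧ x.2 ∈ T x.1})
    {f : α × β → F}
    (hf : IntegrableOn f {x | x.1 ∈ A ∧ x.2 ∈ T x.1} (μ.prod ν)) :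
    IntegrableOn (fun a => ∫ b in T a, f (a, b) ∂ν) A μ := by
  have h := ((integrable_indicator_iff hD).2 hf).integral_prod_left
  rw [← integrable_indicator_iff hA]
  refine h.congr (Eventually.of_forall fun a => ?_)
  simp only
  rw [indicator_setOf_mem_and_mem]
  by_cases ha : a ∈ A
  · rw [Set.indicator_of_mem ha, Set.indicator_of_mem ha, integral_indicator (hT a)]
  · simp [Set.indicator_of_notMem ha]

theorem integrableOn_slice_of_fst [SFinite ν]
    (hA : MeasurableSet A) (hT : ∀ a, MeasurableSet (T a))
    (hD : MeasurableSet {x : α × β | x.1 ∈ A ∧ x.2 ∈ T x.1})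
    {h : α → ℝ}
    (hT_fin : ∀ a ∈ A, ν (T a) ≠ ⊤) (hh : AEStronglyMeasurable h (μ.restrict A))
    (hint : IntegrableOn (fun a => ‖h a‖ * ν.real (T a)) A μ) :
    IntegrableOn (fun x : α × β => h x.1) {x | x.1 ∈ A ∧ x.2 ∈ T x.1} (μ.prod ν) := by
  have hm : AEStronglyMeasurable ({x : α × β | x.1 ∈ A ∧ x.2 ∈ T x.1}.indicator fun x => h x.1)
      (μ.prod ν) := by
    have h1 : AEStronglyMeasurable (fun x : α × β => A.indicator h x.1) (μ.prod ν) :=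
      ((aestronglyMeasurable_indicator_iff hA).2 hh).comp_fst
    refine (h1.indicator hD).congr (Eventually.of_forall fun x => ?_)
    by_cases hx : x ∈ {x : α × β | x.1 ∈ A ∧ x.2 ∈ T x.1}
    · rw [Set.indicator_of_mem hx, Set.indicator_of_mem hx, Set.indicator_of_mem hx.1]
    · rw [Set.indicator_of_notMem hx, Set.indicator_of_notMem hx]
  rw [← integrable_indicator_iff hD, integrable_prod_iff hm]
  refine ⟨Eventually.of_forall fun a => ?_, ?_⟩
  · rw [indicator_setOf_mem_and_mem]
    by_cases ha : a ∈ A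
    · rw [Set.indicator_of_mem ha, integrable_indicator_iff (hT a)]
      exact integrableOn_const (C := h a) (hT_fin a ha)
    · simp [Set.indicator_of_notMem ha]
  · refine ((integrable_indicator_iff hA).2 hint).congr (Eventually.of_forall fun a => ?_)
    have := indicator_setOf_mem_and_mem (A := A) (T := T) (fun x : α × β => ‖h x.1‖) a
    simp only [norm_indicator_eq_indicator_norm]
    rw [this]
    by_cases ha : a ∈ A
    · rw [Set.indicator_of_mem ha, Set.indicator_of_mem ha, integral_indicator (hT a)]
      simp [mul_comm]
    · simp [Set.indicator_of_notMem ha]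

end Slices

/-- Cauchy–Schwarz against the constant 1, read off from `∫ (N ‖f‖ - I)² ≥ 0`; division by the total
mass `N` leaves the case `N = 0` apart. -/
theorem norm_setIntegral_sq_le {α : Type*} [MeasurableSpace α] {ν : Measure α} [IsFiniteMeasure ν]
    {f : α → ℂ} (hf : Integrable f ν) (hf2 : Integrable (fun x => ‖f x‖ ^ 2) ν) :
    ‖∫ x, f x ∂ν‖ ^ 2 ≤ ν.real Set.univ * ∫ x, ‖f x‖ ^ 2 ∂ν := by
  set N := ν.real Set.univ with hN
  set I := ∫ x, ‖f x‖ ∂ν with hI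
  have hN0 : 0 ≤ N := measureReal_nonneg
  have hle : ‖∫ x, f x ∂ν‖ ≤ I := norm_integral_le_integral_norm f
  have h0 : 0 ≤ ∫ x, (N * ‖f x‖ - I) ^ 2 ∂ν := integral_nonneg fun x => sq_nonneg _
  have e : ∫ x, (N * ‖f x‖ - I) ^ 2 ∂ν = N * (N * ∫ x, ‖f x‖ ^ 2 ∂ν - I ^ 2) := by
    have : ∀ x, (N * ‖f x‖ - I) ^ 2 = N ^ 2 * ‖f x‖ ^ 2 - 2 * N * I * ‖f x‖ + I ^ 2 := fun x => by
      ring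
    simp only [this]
    have h1 : Integrable (fun x => N ^ 2 * ‖f x‖ ^ 2 - 2 * N * I * ‖f x‖) ν :=
      (hf2.const_mul _).sub (hf.norm.const_mul _)
    rw [integral_add h1 (integrable_const _), integral_sub (hf2.const_mul _) (hf.norm.const_mul _), integral_const_mul, integral_const_mul,
      integral_const, ← hN, ← hI, smul_eq_mul]
    ring
  rw [e] at h0
  refine (pow_le_pow_left₀ (norm_nonneg _) hle 2).trans ?_
  rcases hN0.eq_or_lt with h | h
  · have : ν = 0 := by
      rw [← Measure.measure_univ_eq_zero]
      exact (measureReal_eq_zero_iff (measure_ne_top ν _)).1 h.symm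
    simp [hI, this]
  · have := nonneg_of_mul_nonneg_right h0 h
    linarith

/-! ### Square integrable holomorphic functions and the kernel on the Hartogs domain -/

section HartogsDomain

open Metric Filter Module

theorem isOpen_setOf_norm_sq_lt {V W : Type*} [TopologicalSpace V] [SeminormedAddCommGroup W]
    {Ω : Set V} {p : V → ℝ} (hΩ : IsOpen Ω) (hp : ContinuousOn p Ω) :
    IsOpen {x : V × W | x.1 ∈ Ω ∧ ‖x.2‖ ^ 2 < p x.1} := by
  have h : ContinuousOn (fun x : V × W => p x.1 - ‖x.2‖ ^ 2) (Prod.fst ⁻¹' Ω) :=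
    (hp.comp continuousOn_fst fun x hx => hx).sub (by fun_prop)
  have := h.isOpen_inter_preimage (hΩ.preimage continuous_fst) isOpen_Ioi (t := Set.Ioi 0)
  convert this using 1
  ext x
  simp

variable {V W : Type*} [NormedAddCommGroup V] [NormedSpace ℂ V]
  [NormedAddCommGroup W] [InnerProductSpace ℂ W]
  {Ω : Set V} {p : V → ℝ}

theorem differentiableOn_slice {f : V × W → ℂ}
    (hf : DifferentiableOn ℂ f {x : V × W | x.1 ∈ Ω ∧ ‖x.2‖ ^ 2 < p x.1}) {z : V} (hz : z ∈ Ω) :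
    DifferentiableOn ℂ (fun Z => f (z, Z)) {Z : W | ‖Z‖ ^ 2 < p z} :=
  hf.comp (by fun_prop) fun _ hZ => ⟨hz, hZ⟩

theorem differentiableOn_homogeneousPart_slice [FiniteDimensional ℂ V] (hΩ : IsOpen Ω)
    (hp : ContinuousOn p Ω) (hp0 : ∀ z ∈ Ω, 0 < p z) {f : V × W → ℂ}
    (hf : DifferentiableOn ℂ f {x : V × W | x.1 ∈ Ω ∧ ‖x.2‖ ^ 2 < p x.1}) (k : ℕ) (w : W) :
    DifferentiableOn ℂ (fun z => homogeneousPart (fun Z => f (z, Z)) k w) Ω := by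
  have h := differentiableOn_iteratedDeriv_snd (E := V)
    (U := (fun x : V × ℂ => (x.1, x.2 • w)) ⁻¹' {x : V × W | x.1 ∈ Ω ∧ ‖x.2‖ ^ 2 < p x.1})
    ((isOpen_setOf_norm_sq_lt hΩ hp).preimage (by fun_prop))
    (g := fun x => f (x.1, x.2 • w)) (hf.comp (by fun_prop) fun x hx => hx) k
  exact (h.mono fun z hz => ⟨hz, by simpa using hp0 z hz⟩).const_mul _

theorem norm_conj_inner_pow_sq_le {s : ℝ} (w : W) (k : ℕ) {Z : W} (hZ : ‖Z‖ ^ 2 < s) :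
    ‖conj (inner ℂ w Z) ^ k‖ ^ 2 ≤ (‖w‖ ^ 2 * s) ^ k := by
  rw [norm_pow, RCLike.norm_conj, ← pow_mul, mul_comm, pow_mul]
  refine pow_le_pow_left₀ (by positivity) ?_ k
  calc ‖inner ℂ w Z‖ ^ 2 ≤ (‖w‖ * ‖Z‖) ^ 2 := by gcongr; exact norm_inner_le_norm w Z
    _ = ‖w‖ ^ 2 * ‖Z‖ ^ 2 := by ring
    _ ≤ _ := by gcongr

variable [FiniteDimensional ℂ V] [MeasurableSpace V] [BorelSpace V] {μ : Measure V}
  [FiniteDimensional ℂ W] [MeasurableSpace W] [BorelSpace W]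

theorem measurableSet_setOf_norm_sq_lt (hΩ : IsOpen Ω) (hp : ContinuousOn p Ω) :
    MeasurableSet {x : V × W | x.1 ∈ Ω ∧ ‖x.2‖ ^ 2 < p x.1} := by
  have : ProperSpace V := FiniteDimensional.proper ℂ V
  exact (isOpen_setOf_norm_sq_lt hΩ hp).measurableSet

variable [Nontrivial W]

theorem hermitianVolume_real_setOf_norm_sq_lt {s : ℝ} (hs : 0 < s) :
    (hermitianVolume W).real {Z | ‖Z‖ ^ 2 < s} = s ^ finrank ℂ W := by
  rw [measureReal_def, hermitianVolume_setOf_norm_sq_lt hs, ENNReal.toReal_ofReal (by positivity)]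

theorem integrableOn_of_integrableOn_norm_sq {s : ℝ} (hs : 0 < s) {g : W → ℂ}
    (hg : DifferentiableOn ℂ g {Z | ‖Z‖ ^ 2 < s})
    (hint : IntegrableOn (fun Z => ‖g Z‖ ^ 2) {Z | ‖Z‖ ^ 2 < s} (hermitianVolume W)) :
    IntegrableOn g {Z | ‖Z‖ ^ 2 < s} (hermitianVolume W) := by
  have : ProperSpace W := FiniteDimensional.proper ℂ W
  have hm : MeasurableSet {Z : W | ‖Z‖ ^ 2 < s} := measurableSet_lt (by fun_prop) (by fun_prop)
  have : IsFiniteMeasure ((hermitianVolume W).restrict {Z | ‖Z‖ ^ 2 < s}) :=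
    ⟨by rw [Measure.restrict_apply_univ, hermitianVolume_setOf_norm_sq_lt hs]
        exact ENNReal.ofReal_lt_top⟩
  have hsm := hg.continuousOn.aestronglyMeasurable hm (μ := hermitianVolume W)
  exact ((memLp_two_iff_integrable_sq_norm hsm).2 hint).integrable one_le_two

/-- Cauchy–Schwarz in `setIntegral_mul_conj_inner_pow`: the fibre volume `s^d` and the bound `(‖w‖²
s)^k` together cancel one of the two factors `s^(k+d)`. With `s = p z`, integration over the base
places homogeneous parts in the space of weight `p^(k+d)`. -/
theorem norm_sq_homogeneousPart_mul_le {s : ℝ} (hs : 0 < s) {g : W → ℂ}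
    (hg : DifferentiableOn ℂ g {Z | ‖Z‖ ^ 2 < s})
    (hint : IntegrableOn (fun Z => ‖g Z‖ ^ 2) {Z | ‖Z‖ ^ 2 < s} (hermitianVolume W))
    (k : ℕ) (w : W) :
    ‖homogeneousPart g k w‖ ^ 2 * s ^ (k + finrank ℂ W) ≤
      ((k + finrank ℂ W).choose (finrank ℂ W)) ^ 2 * (‖w‖ ^ 2) ^ k *
        ∫ Z in {Z | ‖Z‖ ^ 2 < s}, ‖g Z‖ ^ 2 ∂(hermitianVolume W) := by
  have : ProperSpace W := FiniteDimensional.proper ℂ W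
  have hm : MeasurableSet {Z : W | ‖Z‖ ^ 2 < s} := measurableSet_lt (by fun_prop) (by fun_prop)
  have : IsFiniteMeasure ((hermitianVolume W).restrict {Z | ‖Z‖ ^ 2 < s}) :=
    ⟨by rw [Measure.restrict_apply_univ, hermitianVolume_setOf_norm_sq_lt hs]
        exact ENNReal.ofReal_lt_top⟩
  have hgi := integrableOn_of_integrableOn_norm_sq hs hg hint
  set ν := hermitianVolume W with hν
  set d := finrank ℂ W with hd
  set S : Set W := {Z | ‖Z‖ ^ 2 < s} with hS
  have hb : ∀ᵐ Z ∂ν.restrict S, ‖conj (inner ℂ w Z) ^ k‖ ^ 2 ≤ (‖w‖ ^ 2 * s) ^ k := by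
    filter_upwards [ae_restrict_mem hm] with Z hZ
    exact norm_conj_inner_pow_sq_le w k hZ
  have hi1 : Integrable (fun Z => g Z * conj (inner ℂ w Z) ^ k) (ν.restrict S) := by
    refine Integrable.mul_bdd (c := √((‖w‖ ^ 2 * s) ^ k)) hgi
      (Continuous.aestronglyMeasurable (by fun_prop)) ?_
    filter_upwards [hb] with Z hZ
    exact Real.le_sqrt_of_sq_le hZ
  have hle : ∀ᵐ Z ∂ν.restrict S, ‖g Z * conj (inner ℂ w Z) ^ k‖ ^ 2 ≤
      (‖w‖ ^ 2 * s) ^ k * ‖g Z‖ ^ 2 := by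
    filter_upwards [hb] with Z hZ
    rw [norm_mul, mul_pow, mul_comm]
    gcongr
  have hi2 : Integrable (fun Z => ‖g Z * conj (inner ℂ w Z) ^ k‖ ^ 2) (ν.restrict S) := by
    refine (hint.const_mul ((‖w‖ ^ 2 * s) ^ k)).mono' (hi1.aestronglyMeasurable.norm.pow 2) ?_
    filter_upwards [hle] with Z hZ
    rwa [Real.norm_of_nonneg (by positivity)]
  have h1 := norm_setIntegral_sq_le hi1 hi2
  rw [measureReal_restrict_apply_univ, hermitianVolume_real_setOf_norm_sq_lt hs] at h1
  have h2 := integral_mono_ae hi2 (hint.const_mul ((‖w‖ ^ 2 * s) ^ k)) hle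
  rw [integral_const_mul] at h2
  have h3 := congrArg (fun x : ℂ => ‖x‖ ^ 2) (setIntegral_mul_conj_inner_pow hs hg hgi k w)
  simp only [norm_mul, mul_pow, Complex.norm_natCast, Complex.norm_real,
    Real.norm_of_nonneg (pow_nonneg hs.le _)] at h3
  have hsp : 0 < s ^ (k + d) := pow_pos hs _
  refine le_of_mul_le_mul_left ?_ hsp
  calc s ^ (k + d) * (‖homogeneousPart g k w‖ ^ 2 * s ^ (k + d))
      = (s ^ (k + d)) ^ 2 * ‖homogeneousPart g k w‖ ^ 2 := by ring
    _ = ((k + d).choose d) ^ 2 * ‖∫ Z in S, g Z * conj (inner ℂ w Z) ^ k ∂ν‖ ^ 2 := h3.symm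
    _ ≤ ((k + d).choose d) ^ 2 *
        (s ^ d * ((‖w‖ ^ 2 * s) ^ k * ∫ Z in S, ‖g Z‖ ^ 2 ∂ν)) := by
        gcongr
        exact h1.trans (by gcongr)
    _ = _ := by rw [mul_pow, pow_add]; ring

/-- Products of functions in a weighted Bergman space of the base with powers of a linear form
are square integrable on the Hartogs domain. -/
theorem memBergman_mul_inner_pow (hΩ : IsOpen Ω)
    (hp : ContinuousOn p Ω) (hp0 : ∀ z ∈ Ω, 0 < p z) {h : V → ℂ} {k : ℕ}
    (hh : MemBergman μ Ω (fun z => p z ^ (k + finrank ℂ W)) h) (w : W) :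
    MemBergman (μ.prod (hermitianVolume W)) {x : V × W | x.1 ∈ Ω ∧ ‖x.2‖ ^ 2 < p x.1}
      (fun _ => 1) (fun x => h x.1 * inner ℂ w x.2 ^ k) := by
  have : ProperSpace V := FiniteDimensional.proper ℂ V
  have : ProperSpace W := FiniteDimensional.proper ℂ W
  have hd : DifferentiableOn ℂ (fun x : V × W => h x.1 * inner ℂ w x.2 ^ k)
      {x : V × W | x.1 ∈ Ω ∧ ‖x.2‖ ^ 2 < p x.1} :=
    (hh.1.comp (by fun_prop) fun x hx => hx.1).mul
      (((innerSL ℂ w).differentiable.comp differentiable_snd).pow k).differentiableOn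
  refine ⟨hd, ?_⟩
  have hT : ∀ z, MeasurableSet {Z : W | ‖Z‖ ^ 2 < p z} := fun z =>
    measurableSet_lt (by fun_prop) (by fun_prop)
  have hD := measurableSet_setOf_norm_sq_lt (W := W) hΩ hp
  have hdom : IntegrableOn (fun x : V × W => ‖h x.1‖ ^ 2 * (‖w‖ ^ 2 * p x.1) ^ k)
      {x : V × W | x.1 ∈ Ω ∧ ‖x.2‖ ^ 2 < p x.1} (μ.prod (hermitianVolume W)) := by
    refine integrableOn_slice_of_fst (h := fun z => ‖h z‖ ^ 2 * (‖w‖ ^ 2 * p z) ^ k)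
      hΩ.measurableSet hT hD
      (fun z hz => ?_) ?_ ?_
    · rw [hermitianVolume_setOf_norm_sq_lt (hp0 z hz)]; exact ENNReal.ofReal_ne_top
    · exact ((hh.1.continuousOn.norm.pow 2).mul ((continuousOn_const.mul hp).pow _)
        ).aestronglyMeasurable hΩ.measurableSet
    -- The fibre over `z` has volume `p z ^ d`, which raises the weight from `p^k` to `p^(k+d)`.
    · refine IntegrableOn.congr_fun (hh.2.const_mul ((‖w‖ ^ 2) ^ k)) (fun z hz => ?_)
        hΩ.measurableSet
      have := hp0 z hz
      simp only
      rw [hermitianVolume_real_setOf_norm_sq_lt this, Real.norm_of_nonneg (by positivity)]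
      ring
  refine hdom.mono' ((hd.continuousOn.norm.pow 2).mul continuousOn_const |>.aestronglyMeasurable hD)
    ?_
  filter_upwards [ae_restrict_mem hD] with x hx
  rw [mul_one, Real.norm_of_nonneg (by positivity), norm_mul, mul_pow]
  gcongr
  have := norm_conj_inner_pow_sq_le w k hx.2
  rwa [norm_pow, RCLike.norm_conj, ← norm_pow] at this

variable [SFinite μ]

/-- Homogeneous parts of square integrable holomorphic functions on a Hartogs domain belong to a
weighted Bergman space of the base. -/
theorem memBergman_homogeneousPart (hΩ : IsOpen Ω)
    (hp : ContinuousOn p Ω) (hp0 : ∀ z ∈ Ω, 0 < p z) {f : V × W → ℂ}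
    (hf : MemBergman (μ.prod (hermitianVolume W)) {x : V × W | x.1 ∈ Ω ∧ ‖x.2‖ ^ 2 < p x.1}
      (fun _ => 1) f) (k : ℕ) (w : W) :
    MemBergman μ Ω (fun z => p z ^ (k + finrank ℂ W))
      (fun z => homogeneousPart (fun Z => f (z, Z)) k w) := by
  have : ProperSpace V := FiniteDimensional.proper ℂ V
  have hd := differentiableOn_homogeneousPart_slice hΩ hp hp0 hf.1 k w
  refine ⟨hd, ?_⟩
  have hT : ∀ z, MeasurableSet {Z : W | ‖Z‖ ^ 2 < p z} := fun z =>
    measurableSet_lt (by fun_prop) (by fun_prop)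
  have hD := measurableSet_setOf_norm_sq_lt (W := W) hΩ hp
  have hint : IntegrableOn (fun x => ‖f x‖ ^ 2) {x : V × W | x.1 ∈ Ω ∧ ‖x.2‖ ^ 2 < p x.1}
      (μ.prod (hermitianVolume W)) := by simpa only [mul_one] using hf.2
  have h1 := integrableOn_integral_slice hΩ.measurableSet hT hD hint
  refine Integrable.mono' (h1.const_mul
      (((k + finrank ℂ W).choose (finrank ℂ W)) ^ 2 * (‖w‖ ^ 2) ^ k))
    ((hd.continuousOn.norm.pow 2).mul (hp.pow _) |>.aestronglyMeasurable hΩ.measurableSet) ?_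
  filter_upwards [ae_restrict_mem hΩ.measurableSet,
    ae_integrableOn_slice hΩ.measurableSet hT hD hint] with z hz hzi
  have := hp0 z hz
  rw [Real.norm_of_nonneg (by positivity)]
  exact norm_sq_homogeneousPart_mul_le (hp0 z hz) (differentiableOn_slice hf.1 hz) hzi k w

/-- The inner product with `C(k + d, d) K(z, w₀) ⟨Z, w⟩ ^ k`, `K` being the kernel for the weight
`p ^ (k + d)`, evaluates the homogeneous part of degree `k` at `(w₀, w)`. -/
theorem setIntegral_mul_conj_kernel_mul_inner_pow (hΩ : IsOpen Ω)
    (hp : ContinuousOn p Ω) (hp0 : ∀ z ∈ Ω, 0 < p z) {f : V × W → ℂ}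
    (hf : MemBergman (μ.prod (hermitianVolume W)) {x : V × W | x.1 ∈ Ω ∧ ‖x.2‖ ^ 2 < p x.1}
      (fun _ => 1) f) {k : ℕ} {K : V → V → ℂ}
    (hK : IsBergmanKernel μ Ω (fun z => p z ^ (k + finrank ℂ W)) K) {w₀ : V} (hw₀ : w₀ ∈ Ω) (w : W) :
    ∫ x in {x : V × W | x.1 ∈ Ω ∧ ‖x.2‖ ^ 2 < p x.1}, f x *
        conj ((k + finrank ℂ W).choose (finrank ℂ W) * (K x.1 w₀ * inner ℂ w x.2 ^ k))
        ∂(μ.prod (hermitianVolume W)) =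
      homogeneousPart (fun Z => f (w₀, Z)) k w := by
  have : ProperSpace V := FiniteDimensional.proper ℂ V
  have : ProperSpace W := FiniteDimensional.proper ℂ W
  have hT : ∀ z, MeasurableSet {Z : W | ‖Z‖ ^ 2 < p z} := fun z =>
    measurableSet_lt (by fun_prop) (by fun_prop)
  have hD := measurableSet_setOf_norm_sq_lt (W := W) hΩ hp
  have hG := memBergman_mul_inner_pow (W := W) hΩ hp hp0 (hK w₀ hw₀).1 w
  have hfi : IntegrableOn (fun x => ‖f x‖ ^ 2) {x : V × W | x.1 ∈ Ω ∧ ‖x.2‖ ^ 2 < p x.1}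
      (μ.prod (hermitianVolume W)) := by simpa only [mul_one] using hf.2
  have hGi : IntegrableOn (fun x => ‖K x.1 w₀ * inner ℂ w x.2 ^ k‖ ^ 2)
      {x : V × W | x.1 ∈ Ω ∧ ‖x.2‖ ^ 2 < p x.1}
      (μ.prod (hermitianVolume W)) := by simpa only [mul_one] using hG.2
  set C : ℂ := (((k + finrank ℂ W).choose (finrank ℂ W) : ℕ) : ℂ) with hC
  have hint : IntegrableOn (fun x => f x * conj (C * (K x.1 w₀ * inner ℂ w x.2 ^ k)))
      {x : V × W | x.1 ∈ Ω ∧ ‖x.2‖ ^ 2 < p x.1} (μ.prod (hermitianVolume W)) := by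
    refine ((hfi.add hGi).const_mul ‖C‖).mono' ((hf.1.continuousOn.mul
      (Complex.continuous_conj.comp_continuousOn
        (continuousOn_const.mul hG.1.continuousOn))).aestronglyMeasurable hD)
      (Eventually.of_forall fun x => ?_)
    rw [norm_mul, RCLike.norm_conj, norm_mul, mul_left_comm]
    refine mul_le_mul_of_nonneg_left ?_ (norm_nonneg _)
    simp only [Pi.add_apply]
    nlinarith [sq_nonneg (‖f x‖ - ‖K x.1 w₀ * inner ℂ w x.2 ^ k‖), sq_nonneg ‖f x‖,
      sq_nonneg ‖K x.1 w₀ * inner ℂ w x.2 ^ k‖]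
  refine (setIntegral_slice hΩ.measurableSet hT hD hint).trans ?_
  -- Reproducing the homogeneous part by `K` turns the claim into an identity between integrands
  -- over `Ω`; it is the fibrewise extraction formula with `s = p z`.
  rw [(hK w₀ hw₀).2 _ (memBergman_homogeneousPart hΩ hp hp0 hf k w)]
  refine integral_congr_ae ?_
  filter_upwards [ae_restrict_mem hΩ.measurableSet,
    ae_integrableOn_slice hΩ.measurableSet hT hD hfi] with z hz hzi
  have hzd := differentiableOn_slice hf.1 hz
  have h := setIntegral_mul_conj_inner_pow (hp0 z hz) hzd
    (integrableOn_of_integrableOn_norm_sq (hp0 z hz) hzd hzi) k w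
  have e : ∀ Z : W, f (z, Z) * conj (C * (K z w₀ * inner ℂ w Z ^ k)) =
      conj (K z w₀) * C * (f (z, Z) * conj (inner ℂ w Z) ^ k) := fun Z => by
    rw [hC, map_mul, map_mul, map_pow, Complex.conj_natCast]
    ring
  simp only [e]
  rw [integral_const_mul, mul_assoc, h]
  ring

/-- Expansion of the Bergman kernel of a Hartogs domain in terms of the weighted Bergman kernels
of the base. -/
theorem hasSum_kernel_hartogs (hΩ : IsOpen Ω)
    (hp : ContinuousOn p Ω) (hp0 : ∀ z ∈ Ω, 0 < p z) {K : ℕ → V → V → ℂ}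
    (hK : ∀ k, IsBergmanKernel μ Ω (fun z => p z ^ k) (K k)) {L : V × W → V × W → ℂ}
    (hL : IsBergmanKernel (μ.prod (hermitianVolume W))
      {x : V × W | x.1 ∈ Ω ∧ ‖x.2‖ ^ 2 < p x.1} (fun _ => 1) L)
    {x y : V × W} (hx : x.1 ∈ Ω ∧ ‖x.2‖ ^ 2 < p x.1) (hy : y.1 ∈ Ω ∧ ‖y.2‖ ^ 2 < p y.1) :
    HasSum (fun k => ((k + finrank ℂ W).choose (finrank ℂ W) : ℂ) *
      K (k + finrank ℂ W) x.1 y.1 * inner ℂ y.2 x.2 ^ k) (L x y) := by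
  have hsl := differentiableOn_slice (hL y hy).1.1 hx.1
  rw [setOf_norm_sq_lt_eq_ball] at hsl
  have h := hasSum_homogeneousPart hsl (Z := x.2)
    (by rw [← setOf_norm_sq_lt_eq_ball]; exact hx.2)
  convert h using 2 with k
  have hG := memBergman_mul_inner_pow (W := W) hΩ hp hp0
    (hK (k + finrank ℂ W) x.1 hx.1).1 x.2
  have hCG : MemBergman (μ.prod (hermitianVolume W))
      {x : V × W | x.1 ∈ Ω ∧ ‖x.2‖ ^ 2 < p x.1} (fun _ => 1)
      (fun u => ((k + finrank ℂ W).choose (finrank ℂ W) : ℂ) *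
        (K (k + finrank ℂ W) u.1 x.1 * inner ℂ x.2 u.2 ^ k)) := by
    refine ⟨hG.1.const_mul _, ?_⟩
    refine (hG.2.const_mul (‖((k + finrank ℂ W).choose (finrank ℂ W) : ℂ)‖ ^ 2)).congr
      (Eventually.of_forall fun u => ?_)
    simp only [norm_mul, mul_pow, mul_one]
  rw [← setIntegral_mul_conj_kernel_mul_inner_pow hΩ hp hp0 (hL y hy).1 (hK _) hx.1 x.2]
  -- The pairing of `L(·, y)` with the test function centred at `x` is already the degree `k` part
  -- of `L(·, y)` at `x`. The reproducing property of `L` makes it the conjugate of the test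
  -- function's value at `y`, which is the required term.
  have h1 := congrArg conj ((hL y hy).2 _ hCG)
  rw [← integral_conj] at h1
  simp only [map_mul, Complex.conj_conj, Complex.conj_natCast, map_pow, inner_conj_symm,
    Complex.ofReal_one, mul_one] at h1 ⊢
  rw [(hK _).conj_symm hy.1 hx.1] at h1
  rw [mul_assoc, h1]
  refine integral_congr_ae (Eventually.of_forall fun u => ?_)
  simp only
  ring

end HartogsDomain

/-! ### Termwise differentiation of power series -/

section PowerSeries

open Metric Filter

variable {a : ℕ → ℂ} {ρ : ℝ}

/-- The coefficients of the derived series inherit the hypothesis on `a` with the same `ρ`, which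
lets differentiation be iterated. The comparison is with `(k + 1) (t / s)^k` for some `t < s < ρ`.
-/
theorem summable_norm_succ_mul_mul_pow (ha : ∀ t, 0 ≤ t → t < ρ → Summable fun k => ‖a k‖ * t ^ k)
    {t : ℝ} (ht0 : 0 ≤ t) (ht : t < ρ) :
    Summable fun k : ℕ => ‖((k : ℂ) + 1) * a (k + 1)‖ * t ^ k := by
  obtain ⟨s, hts, hs⟩ := exists_between ht
  have hs0 : 0 < s := ht0.trans_lt hts
  obtain ⟨M, hM⟩ := (ha s hs0.le hs).tendsto_atTop_zero.bddAbove_range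
  have hq : ‖t / s‖ < 1 := by
    rw [Real.norm_of_nonneg (by positivity), div_lt_one hs0]
    exact hts
  have h1 := ((summable_pow_mul_geometric_of_norm_lt_one 1 hq).add
    (summable_geometric_of_norm_lt_one hq)).mul_left (M / s)
  refine h1.of_nonneg_of_le (fun k => by positivity) fun k => ?_
  have hMk : ‖a (k + 1)‖ * s ^ (k + 1) ≤ M := hM ⟨k + 1, rfl⟩
  have hk : ‖(k : ℂ) + 1‖ = k + 1 := by
    rw [← Nat.cast_succ, Complex.norm_natCast, Nat.cast_succ]
  have ha' : ‖a (k + 1)‖ ≤ M / s ^ (k + 1) := by rwa [le_div_iff₀ (by positivity)]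
  rw [norm_mul, hk]
  calc (k + 1 : ℝ) * ‖a (k + 1)‖ * t ^ k ≤ (k + 1 : ℝ) * (M / s ^ (k + 1)) * t ^ k := by gcongr
    _ = _ := by rw [div_pow, pow_succ, pow_one]; field_simp

theorem hasDerivAt_tsum_mul_pow (ha : ∀ t, 0 ≤ t → t < ρ → Summable fun k => ‖a k‖ * t ^ k)
    {r : ℂ} (hr : ‖r‖ < ρ) :
    HasDerivAt (fun s => ∑' k, a k * s ^ k) (∑' k : ℕ, ((k : ℂ) + 1) * a (k + 1) * r ^ k) r := by
  obtain ⟨t, hrt, ht⟩ := exists_between hr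
  have ht0 : 0 < t := (norm_nonneg r).trans_lt hrt
  have hb := summable_norm_succ_mul_mul_pow ha ht0.le ht
  -- The truncated exponent at `k = 0` is harmless, since the factor `k` vanishes there.
  have hu : Summable fun k : ℕ => ‖(k : ℂ) * a k‖ * t ^ (k - 1) := by
    rw [← summable_nat_add_iff 1]
    simpa using hb
  have hle : ∀ (k : ℕ) (s : ℂ), ‖s‖ ≤ t →
      ‖a k * (k * s ^ (k - 1))‖ ≤ ‖(k : ℂ) * a k‖ * t ^ (k - 1) := fun k s hs => by
    rw [← mul_assoc, mul_comm (a k), norm_mul, norm_pow]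
    gcongr
  have h := hasDerivAt_tsum_of_isPreconnected (g := fun k s => a k * s ^ k)
    (g' := fun k s => a k * (k * s ^ (k - 1))) (y₀ := 0) hu isOpen_ball
    (convex_ball (0 : ℂ) t).isPreconnected
    (fun k s _ => (hasDerivAt_pow k s).const_mul (a k))
    (fun k s hs => hle k s (mem_ball_zero_iff.1 hs).le) (mem_ball_self ht0)
    ((hasSum_single 0 fun k hk => by simp [hk]).summable) (by simpa using hrt)
  refine h.congr_deriv ?_
  rw [(hu.of_norm_bounded fun k => hle k r hrt.le).tsum_eq_zero_add]
  simp only [Nat.cast_zero, zero_mul, mul_zero, zero_add, Nat.cast_succ, Nat.add_sub_cancel]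
  exact tsum_congr fun k => by ring

theorem factorial_mul_choose_mul_succ (m k : ℕ) (c : ℂ) :
    (m.factorial : ℂ) * (((k + m).choose m : ℂ) * (((k + m : ℕ) : ℂ) + 1) * c) =
      ((m + 1).factorial : ℂ) * (((k + (m + 1)).choose (m + 1) : ℂ) * c) := by
  have h : ((k + m + 1 : ℕ) : ℂ) * ((k + m).choose m : ℂ) =
      ((k + m + 1).choose (m + 1) : ℂ) * ((m + 1 : ℕ) : ℂ) := by
    exact_mod_cast Nat.add_one_mul_choose_eq (k + m) m
  rw [Nat.factorial_succ, ← add_assoc]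
  push_cast at h ⊢
  linear_combination (m.factorial * c) * h

/-- Iterated derivatives of a power series. -/
theorem iteratedDeriv_tsum_mul_pow (m : ℕ) :
    ∀ {a : ℕ → ℂ}, (∀ t, 0 ≤ t → t < ρ → Summable fun k => ‖a k‖ * t ^ k) → ∀ {r : ℂ}, ‖r‖ < ρ →
    iteratedDeriv m (fun s => ∑' k, a k * s ^ k) r =
      m.factorial * ∑' k, ((k + m).choose m : ℂ) * a (k + m) * r ^ k := by
  induction m with
  | zero => intro a _ r _; simp
  | succ m ih =>
    intro a ha r hr
    have hev : deriv (fun s => ∑' k, a k * s ^ k) =ᶠ[𝓝 r]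
        fun s => ∑' k : ℕ, ((k : ℂ) + 1) * a (k + 1) * s ^ k := by
      filter_upwards [isOpen_ball.mem_nhds (show r ∈ ball (0 : ℂ) ρ by simpa using hr)] with s hs
      exact (hasDerivAt_tsum_mul_pow ha (by simpa using hs)).deriv
    -- One derivative is taken first and the induction hypothesis is used for the derived
    -- coefficients, so the induction must quantify over `a`.
    rw [iteratedDeriv_succ', hev.iteratedDeriv_eq,
      ih (fun t ht0 ht => summable_norm_succ_mul_mul_pow ha ht0 ht) hr, ← tsum_mul_left,
      ← tsum_mul_left]
    refine tsum_congr fun k => ?_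
    rw [mul_assoc ((k + (m + 1)).choose (m + 1) : ℂ), ← factorial_mul_choose_mul_succ]
    simp only [add_assoc]
    ring

/-- Real and complex differentiation produce the same derived series. This links
`diagVirtualBergmanDeriv`, with its real variable, to `virtualBergmanDeriv`. -/
theorem iteratedDeriv_tsum_mul_ofReal_pow (m : ℕ) :
    ∀ {a : ℕ → ℂ}, (∀ t, 0 ≤ t → t < ρ → Summable fun k => ‖a k‖ * t ^ k) → ∀ {r : ℝ}, |r| < ρ →
    iteratedDeriv m (fun s : ℝ => ∑' k, a k * (s : ℂ) ^ k) r =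
      iteratedDeriv m (fun s : ℂ => ∑' k, a k * s ^ k) r := by
  induction m with
  | zero => intro a _ r _; simp
  | succ m ih =>
    intro a ha r hr
    have hev : deriv (fun s : ℝ => ∑' k, a k * (s : ℂ) ^ k) =ᶠ[𝓝 r]
        fun s : ℝ => ∑' k : ℕ, ((k : ℂ) + 1) * a (k + 1) * (s : ℂ) ^ k := by
      filter_upwards [isOpen_ball.mem_nhds (show r ∈ ball (0 : ℝ) ρ by simpa using hr)] with s hs
      exact (hasDerivAt_tsum_mul_pow ha (by simpa using hs)).comp_ofReal.deriv
    have hev' : deriv (fun s : ℂ => ∑' k, a k * s ^ k) =ᶠ[𝓝 (r : ℂ)]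
        fun s => ∑' k : ℕ, ((k : ℂ) + 1) * a (k + 1) * s ^ k := by
      filter_upwards [isOpen_ball.mem_nhds (show (r : ℂ) ∈ ball (0 : ℂ) ρ by simpa using hr)]
        with s hs
      exact (hasDerivAt_tsum_mul_pow ha (by simpa using hs)).deriv
    rw [iteratedDeriv_succ', hev.iteratedDeriv_eq, iteratedDeriv_succ', hev'.iteratedDeriv_eq]
    exact ih (fun t ht0 ht => summable_norm_succ_mul_mul_pow ha ht0 ht) hr

/-- Passes from the kernel expansion back to `L₀`: the binomial coefficients are at least 1, and the
first `m` terms, absent from the expansion, do not affect convergence. -/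
theorem summable_norm_mul_pow_of_summable_choose_mul {m : ℕ} (hρ : 0 ≤ ρ)
    (h : Summable fun k => ((k + m).choose m : ℂ) * a (k + m) * (ρ : ℂ) ^ k) {t : ℝ}
    (ht0 : 0 ≤ t) (ht : t ≤ ρ) : Summable fun k => ‖a k‖ * t ^ k := by
  rw [← summable_nat_add_iff m]
  refine (h.norm.mul_left (ρ ^ m)).of_nonneg_of_le (fun k => by positivity) fun k => ?_
  have h1 : (1 : ℝ) ≤ ((k + m).choose m : ℝ) := by
    exact_mod_cast Nat.choose_pos (Nat.le_add_left m k)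
  rw [norm_mul, norm_mul, Complex.norm_natCast, norm_pow, Complex.norm_real,
    Real.norm_of_nonneg hρ]
  calc ‖a (k + m)‖ * t ^ (k + m) ≤ ‖a (k + m)‖ * ρ ^ (k + m) := by gcongr
    _ = ρ ^ m * (1 * ‖a (k + m)‖ * ρ ^ k) := by ring
    _ ≤ _ := by gcongr

end PowerSeries

/-! ### The inflation theorem -/

/-- In Mathlib `inner ℂ W Z` is linear in `Z` and conjugate-linear in `W`: it is the Hermitian
product `⟨Z, W⟩ = ∑ j, Z_j * conj W_j`. -/
theorem theorem1 {V : Type*} [NormedAddCommGroup V] [InnerProductSpace ℂ V]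
    [FiniteDimensional ℂ V] [MeasurableSpace V] [BorelSpace V]
    (Ω : Set V) (hΩ_open : IsOpen Ω) (hΩ_conn : IsConnected Ω)
    (p : V → ℝ) (hp_cont : ContinuousOn p Ω) (hp_pos : ∀ z ∈ Ω, 0 < p z)
    (m : ℕ) (hm : 1 ≤ m) :
    -- the kernels in question exist, i.e. have the reproducing property
    (∀ k : ℕ, IsBergmanKernel (hermitianVolume V) Ω (fun z => p z ^ k) (powerKernel Ω p k)) ∧
    IsBergmanKernel (inflatedVolume V m) (inflatedDomain Ω p m) (fun _ => 1)
      (inflatedBergmanKernel Ω p m) ∧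
    (∀ (z w : V) (Z W : EuclideanSpace ℂ (Fin m)),
      (z, Z) ∈ inflatedDomain Ω p m → (w, W) ∈ inflatedDomain Ω p m →
        -- the series `L₀(z, w; r)` converges for `r` near `⟨Z, W⟩`, with an analytic sum
        (∀ᶠ r in 𝓝 (inner ℂ W Z), Summable fun k : ℕ => powerKernel Ω p k z w * r ^ k) ∧
        AnalyticAt ℂ (virtualBergmanKernel Ω p z w) (inner ℂ W Z) ∧
        inflatedBergmanKernel Ω p m (z, Z) (w, W) =
          virtualBergmanDeriv Ω p m z w (inner ℂ W Z) ∧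
        HasSum (fun k : ℕ => ((k + m).choose m : ℂ) * powerKernel Ω p (k + m) z w *
            (inner ℂ W Z) ^ k)
          (inflatedBergmanKernel Ω p m (z, Z) (w, W))) ∧
    (∀ (z : V) (Z : EuclideanSpace ℂ (Fin m)), (z, Z) ∈ inflatedDomain Ω p m →
        inflatedBergmanKernel Ω p m (z, Z) (z, Z) =
          diagVirtualBergmanDeriv Ω p m z (‖Z‖ ^ 2)) := by
  have : ProperSpace V := FiniteDimensional.proper ℂ V
  have : NeZero m := ⟨by omega⟩
  have : Nontrivial (EuclideanSpace ℂ (Fin m)) :=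
    Module.nontrivial_of_finrank_pos (R := ℂ) (by rw [finrank_euclideanSpace, Fintype.card_fin]; omega)
  have : (inflatedVolume V m).IsAddHaarMeasure := by
    unfold inflatedVolume; infer_instance
  have hK : ∀ k : ℕ, IsBergmanKernel (hermitianVolume V) Ω (fun z => p z ^ k)
      (powerKernel Ω p k) := fun k =>
    isBergmanKernel_bergmanKernel hΩ_open (hp_cont.pow k) fun z hz => pow_pos (hp_pos z hz) k
  have hL : IsBergmanKernel (inflatedVolume V m) (inflatedDomain Ω p m) (fun _ => 1)
      (inflatedBergmanKernel Ω p m) :=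
    isBergmanKernel_bergmanKernel (isOpen_setOf_norm_sq_lt hΩ_open hp_cont) continuousOn_const
      fun _ _ => one_pos
  have hsum : ∀ {z w : V} {Z W : EuclideanSpace ℂ (Fin m)},
      (z, Z) ∈ inflatedDomain Ω p m → (w, W) ∈ inflatedDomain Ω p m →
      HasSum (fun k : ℕ => ((k + m).choose m : ℂ) * powerKernel Ω p (k + m) z w *
        (inner ℂ W Z) ^ k) (inflatedBergmanKernel Ω p m (z, Z) (w, W)) := by
    intro z w Z W hz hw
    have := hasSum_kernel_hartogs hΩ_open hp_cont hp_pos hK hL hz hw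
    simpa only [finrank_euclideanSpace, Fintype.card_fin] using this
  have hrad : ∀ {z w : V} {Z W : EuclideanSpace ℂ (Fin m)},
      (z, Z) ∈ inflatedDomain Ω p m → (w, W) ∈ inflatedDomain Ω p m →
      ∃ ρ : ℝ, ‖inner ℂ W Z‖ < ρ ∧ ∀ t, 0 ≤ t → t < ρ →
        Summable fun k => ‖powerKernel Ω p k z w‖ * t ^ k := by
    intro z w Z W hz hw
    have hex : ∀ {x : V} {X : EuclideanSpace ℂ (Fin m)}, (x, X) ∈ inflatedDomain Ω p m →
        ∃ b : ℝ, ‖X‖ < b ∧ b ^ 2 < p x := by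
      intro x X hx
      obtain ⟨b, hb1, hb2⟩ := exists_between ((Real.lt_sqrt (norm_nonneg X)).2 hx.2)
      exact ⟨b, hb1, (Real.lt_sqrt ((norm_nonneg X).trans hb1.le)).1 hb2⟩
    obtain ⟨b, hb1, hb2⟩ := hex hz
    obtain ⟨c, hc1, hc2⟩ := hex hw
    have hb0 : 0 < b := (norm_nonneg _).trans_lt hb1
    have hc0 : 0 < c := (norm_nonneg _).trans_lt hc1
    -- The coefficients depend only on `z` and `w`, so the fibre vectors may be changed to the
    -- parallel ones `b e` and `c e`, with `b > ‖Z‖` and `c > ‖W‖`. The expansion then converges at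
    -- `c b`, which exceeds `|⟨Z, W⟩|` by Cauchy–Schwarz.
    let e : EuclideanSpace ℂ (Fin m) := EuclideanSpace.single 0 1
    have he : ‖e‖ = 1 := by simp [e]
    have hmem : ∀ {x : V} {s : ℝ}, x ∈ Ω → 0 < s → s ^ 2 < p x →
        (x, (s : ℂ) • e) ∈ inflatedDomain Ω p m := fun hx hs hsp =>
      ⟨hx, by rwa [norm_smul, he, mul_one, Complex.norm_real, Real.norm_of_nonneg hs.le]⟩
    have h := (hsum (hmem hz.1 hb0 hb2) (hmem hw.1 hc0 hc2)).summable
    have hin : inner ℂ ((c : ℂ) • e) ((b : ℂ) • e) = ((c * b : ℝ) : ℂ) := by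
      rw [inner_smul_left, inner_smul_right, inner_self_eq_norm_sq_to_K, he]
      simp
    rw [hin] at h
    refine ⟨c * b, (norm_inner_le_norm W Z).trans_lt
      (mul_lt_mul'' hc1 hb1 (norm_nonneg _) (norm_nonneg _)), fun t ht0 ht =>
      summable_norm_mul_pow_of_summable_choose_mul (a := fun k => powerKernel Ω p k z w) (m := m)
        (by positivity) h ht0 ht.le⟩
  have hderiv : ∀ {z w : V} {Z W : EuclideanSpace ℂ (Fin m)},
      (z, Z) ∈ inflatedDomain Ω p m → (w, W) ∈ inflatedDomain Ω p m →
      inflatedBergmanKernel Ω p m (z, Z) (w, W) =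
        virtualBergmanDeriv Ω p m z w (inner ℂ W Z) := by
    intro z w Z W hz hw
    obtain ⟨ρ, hρ, ha⟩ := hrad hz hw
    have hm0 : (m.factorial : ℂ) ≠ 0 := by exact_mod_cast m.factorial_ne_zero
    simp only [virtualBergmanDeriv, virtualBergmanKernel]
    rw [iteratedDeriv_tsum_mul_pow m ha hρ, (hsum hz hw).tsum_eq, one_div,
      inv_mul_cancel_left₀ hm0]
  refine ⟨hK, hL, fun z w Z W hz hw => ?_, fun z Z hz => ?_⟩
  · obtain ⟨ρ, hρ, ha⟩ := hrad hz hw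
    have hmem : inner ℂ W Z ∈ Metric.ball (0 : ℂ) ρ := by simpa using hρ
    refine ⟨?_, ?_, hderiv hz hw, hsum hz hw⟩
    · filter_upwards [Metric.isOpen_ball.mem_nhds hmem] with r hr
      refine Summable.of_norm ?_
      simpa only [norm_mul, norm_pow] using ha ‖r‖ (norm_nonneg r) (by simpa using hr)
    · exact DifferentiableOn.analyticAt (s := Metric.ball (0 : ℂ) ρ)
        (fun r hr => (hasDerivAt_tsum_mul_pow ha
          (by simpa using hr)).differentiableAt.differentiableWithinAt)
        (Metric.isOpen_ball.mem_nhds hmem)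
  · obtain ⟨ρ, hρ, ha⟩ := hrad hz hz
    have hin : inner ℂ Z Z = ((‖Z‖ ^ 2 : ℝ) : ℂ) := by
      rw [inner_self_eq_norm_sq_to_K]; norm_cast
    rw [hderiv hz hz, hin, virtualBergmanDeriv, diagVirtualBergmanDeriv]
    rw [hin, Complex.norm_real] at hρ
    simp only [diagVirtualBergmanKernel, virtualBergmanKernel]
    rw [iteratedDeriv_tsum_mul_ofReal_pow m ha hρ]
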